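/- **Corollary 3.8.** Let $R$ be a (Noetherian) regular local ring and let $I\subseteq R$ be an ideal such that (a) $I$ has *sliding depth*: for a sequence $z=z_1,\dots,z_n$ generating $I$, the Koszul homology modules satisfy $\operatorname{depth} H_i(z;R)\ge \dim R-n+i$ for all $i\ge 0$ (the zero module has depth $\infty$); (b) $\mu(I_{\mathfrak p})\le \dim R_{\mathfrak p}+1$ for every prime ideal $\mathfrak p\supseteq I$, where $\mu$ denotes the minimal number of generators. Let $s\ge 0$ be an integer and let $J:I$ be a *geometric $s$-residual intersection* of $I$; that is, $J=(\gamma_1,\dots,\gamma_s)\subsetneq I$ is an ideal generated by $s$ elements with $\operatorname{ht}(J:I)\ge s$ and $\operatorname{ht}(I+(J:I))>s$ (where the unit ideal has height $\infty$). Then $J:I$ is a perfect ideal of grade $s$; that is, $J:I\ne R$ and $\operatorname{pd}_R R/(J:I)=\operatorname{grade}(J:I)=s$. -/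

import Mathlib

noncomputable section

namespace ResidualIntersection

/-- The Koszul differential of the sequence `z = z₁, …, zₙ`, on the whole exterior algebra of the
free module `Rⁿ`: contraction with the linear form `eᵢ ↦ zᵢ`, so that
`∂ (v ∧ x) = (∑ vᵢ zᵢ) x - v ∧ ∂ x` and `∂ 1 = 0`. -/
def koszulDifferential {R : Type*} [CommRing R] {n : ℕ} (z : Fin n → R) :
    ExteriorAlgebra R (Fin n → R) →ₗ[R] ExteriorAlgebra R (Fin n → R) :=
  CliffordAlgebra.contractLeft (Fintype.linearCombination R z)

theorem koszulDifferential_ι_mul {R : Type*} [CommRing R] {n : ℕ} (z : Fin n → R)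
    (v : Fin n → R) (x : ExteriorAlgebra R (Fin n → R)) :
    koszulDifferential z (ExteriorAlgebra.ι R v * x) =
      (∑ i, v i * z i) • x - ExteriorAlgebra.ι R v * koszulDifferential z x :=
  CliffordAlgebra.contractLeft_ι_mul _ v x

theorem koszulDifferential_one {R : Type*} [CommRing R] {n : ℕ} (z : Fin n → R) :
    koszulDifferential z 1 = 0 :=
  CliffordAlgebra.contractLeft_one (Q := 0) (Fintype.linearCombination R z)

/-- The cycles of degree `i` of the Koszul complex `K(z; R)`, whose term of degree `i` is the
exterior power `⋀ⁱ Rⁿ`. -/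
def koszulCycles {R : Type*} [CommRing R] {n : ℕ} (z : Fin n → R) (i : ℕ) :
    Submodule R (ExteriorAlgebra R (Fin n → R)) :=
  ⋀[R]^i (Fin n → R) ⊓ LinearMap.ker (koszulDifferential z)

/-- The boundaries of degree `i` of the Koszul complex `K(z; R)`. -/
def koszulBoundaries {R : Type*} [CommRing R] {n : ℕ} (z : Fin n → R) (i : ℕ) :
    Submodule R (ExteriorAlgebra R (Fin n → R)) :=
  (⋀[R]^(i + 1) (Fin n → R)).map (koszulDifferential z)

/-- The differential has degree `-1`. -/
theorem koszulDifferential_mem {R : Type*} [CommRing R] {n : ℕ} (z : Fin n → R) (i : ℕ)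
    {x : ExteriorAlgebra R (Fin n → R)} (hx : x ∈ ⋀[R]^(i + 1) (Fin n → R)) :
    koszulDifferential z x ∈ ⋀[R]^i (Fin n → R) := by
  induction i generalizing x with
  | zero =>
    rw [ExteriorAlgebra.exteriorPower, zero_add, pow_one] at hx
    obtain ⟨v, rfl⟩ := hx
    rw [← mul_one (ExteriorAlgebra.ι R v), koszulDifferential_ι_mul, koszulDifferential_one,
      mul_zero, sub_zero, ExteriorAlgebra.exteriorPower, pow_zero]
    exact Submodule.smul_mem _ _ (Submodule.one_le.mp le_rfl)
  | succ i ih =>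
    rw [ExteriorAlgebra.exteriorPower, pow_succ' _ (i + 1)] at hx
    induction hx using Submodule.mul_induction_on' with
    | mem_mul_mem a ha b hb =>
      obtain ⟨v, rfl⟩ := ha
      rw [koszulDifferential_ι_mul]
      refine Submodule.sub_mem _ (Submodule.smul_mem _ _ hb) ?_
      rw [ExteriorAlgebra.exteriorPower, pow_succ']
      exact Submodule.mul_mem_mul (LinearMap.mem_range_self _ v) (ih hb)
    | add a _ b _ ha hb =>
      rw [map_add]
      exact Submodule.add_mem _ ha hb

theorem koszulBoundaries_le_koszulCycles {R : Type*} [CommRing R] {n : ℕ} (z : Fin n → R)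
    (i : ℕ) : koszulBoundaries z i ≤ koszulCycles z i := by
  rintro _ ⟨x, hx, rfl⟩
  exact ⟨koszulDifferential_mem z i hx, CliffordAlgebra.contractLeft_contractLeft _ x⟩

/-- The Koszul homology module `Hᵢ(z; R)`: cycles modulo boundaries. -/
abbrev KoszulHomology {R : Type*} [CommRing R] {n : ℕ} (z : Fin n → R) (i : ℕ) : Type _ :=
  koszulCycles z i ⧸ (koszulBoundaries z i).submoduleOf (koszulCycles z i)

/-- The grade of the ideal `K` on the module `M`: the supremum of the lengths of the sequences
`x₁, …, xₗ` of elements of `K` such that each `xⱼ` is a nonzerodivisor on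
`M / (x₁, …, xⱼ₋₁) M`. If `R` is Noetherian and `M` is finitely generated, then this is the common
length of the maximal `M`-regular sequences in `K` when `K M ≠ M`, and it is `∞` when `K M = M`. -/
def moduleGrade {R : Type*} [CommRing R] (K : Ideal R) (M : Type*) [AddCommGroup M]
    [Module R M] : ℕ∞ :=
  ⨆ (xs : List R) (_ : (∀ x ∈ xs, x ∈ K) ∧ RingTheory.Sequence.IsWeaklyRegular M xs),
    (xs.length : ℕ∞)

/-- The grade of an ideal of `R`. -/
def grade {R : Type*} [CommRing R] (K : Ideal R) : ℕ∞ :=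
  moduleGrade K R

/-- The depth of a module over a local ring, with the convention `depth 0 = ∞`. -/
def depth (R : Type*) [CommRing R] [IsLocalRing R] (M : Type*) [AddCommGroup M]
    [Module R M] : ℕ∞ :=
  moduleGrade (IsLocalRing.maximalIdeal R) M

/-- The ideal `I` of the local ring `R` has sliding depth if, for a sequence `z₁, …, zₙ` that
generates `I`, one has `depth Hᵢ(z; R) ≥ dim R - n + i` for all `i`. -/
def HasSlidingDepth {R : Type*} [CommRing R] [IsLocalRing R] (I : Ideal R) : Prop :=
  ∃ (n : ℕ) (z : Fin n → R), Ideal.span (Set.range z) = I ∧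
    ∀ i : ℕ, ringKrullDim R + (i : WithBot ℕ∞) ≤
      ((depth R (KoszulHomology z i) + (n : ℕ∞) : ℕ∞) : WithBot ℕ∞)

/-- `μ(I_p)`: the minimal number of generators of the localization of `I` at the prime `p`. -/
def localNumGenerators {R : Type*} [CommRing R] (I p : Ideal R) [p.IsPrime] : ℕ :=
  (I.map (algebraMap R (Localization.AtPrime p))).spanFinrank

/-- `K` is a geometric `s`-residual intersection of `I`: there is an ideal `J = (γ₁, …, γₛ)`
properly contained in `I` such that `K = J : I`, `ht K ≥ s` and `ht (I + K) > s`
(the unit ideal has height `∞`). -/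
def IsGeometricResidualIntersection {R : Type*} [CommRing R] (s : ℕ) (I K : Ideal R) : Prop :=
  ∃ J : Ideal R, (∃ γ : Fin s → R, Ideal.span (Set.range γ) = J) ∧ J < I ∧
    K = J.colon (I : Set R) ∧ (s : ℕ∞) ≤ K.height ∧ (s : ℕ∞) < (I ⊔ K).height

/-- The ideal `K` is perfect: it is proper, and the projective dimension of `R / K` is equal to
the grade of `K`. -/
def IsPerfect {R : Type*} [CommRing R] (K : Ideal R) : Prop :=
  K ≠ ⊤ ∧ CategoryTheory.projectiveDimension (ModuleCat.of R (R ⧸ K)) =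
    ((grade K : ℕ∞) : WithBot ℕ∞)

end ResidualIntersection

end

open IsLocalRing RingTheory.Sequence
open scoped Pointwise

universe u

namespace ResidualIntersection

/-! Write I = (z_1,…,z_r), γ_i = ∑_j c_ij z_j and K = J : I. On V = R^r ⊕ R^s take the form F(v,u) =
∑ v_j z_j, whose Koszul complex is that of z with s zeros adjoined, and the forms ℓ_j(v,u) = v_j +
∑_i c_ij u_i, so that ∑ z_j ℓ_j = F + ∑ γ_i u_i. Let Z_i be the Koszul cycles of F. Contracting Z_r
with all of ℓ_1,…,ℓ_r gives an ideal K' (`cycleIdeal`). This contraction augments a complex whose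
term of degree m is a sum of copies of Z_{r+m}, one for each monomial of degree m in r variables
(`chains`, `diff`).

Sliding depth, together with the bound of the global dimension by dim R, controls the projective
dimension of the Koszul homology, and hence pd Z_{r+m} < s - m, with Z_{r+m} = 0 for m ≥ s. Each x
in K yields vectors w_j with ℓ_k(w_j) = x if k = j, 0 otherwise, and F(w_j) = 0. They give
homotopies by which x^r kills the homology of the augmented complex (`pow_smul_mem_map_diff`).

A finite module of projective dimension < n has only associated primes of height < n
(`height_lt_of_isAssociatedPrime`). As ht K ≥ s, descending along the complex turns "killed by
powers" into exactness, whence pd K' < s and pd R/K' ≤ s (`projDimLT_cycleIdeal`).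

Moreover J ⊆ K' ⊆ K, and x^r ∈ K' for x in K. So K/K' is killed by I and by powers of the elements
of K; since ht (I + K) > s ≥ pd R/K', it vanishes and K = K'. Finally ht K ≥ s forces both the
projective dimension and the grade to equal s. -/

theorem le_of_add_natCast_le_add_natCast {a b : WithBot ℕ∞} {n : ℕ} (h : a + n ≤ b + n) :
    a ≤ b := by
  induction a with
  | bot => exact bot_le
  | coe a =>
    induction b with
    | bot => exact absurd h (by rw [WithBot.bot_add]; exact not_le_of_gt (WithBot.bot_lt_coe _))
    | coe b =>
      have h' : a + (n : ℕ∞) ≤ b + (n : ℕ∞) := by exact_mod_cast h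
      exact WithBot.coe_le_coe.mpr ((ENat.add_le_add_iff_right (ENat.natCast_ne_top n)).mp h')

/-! ### Regular local rings: parameters, integrality, regular sequences. -/

section RegularLocal

/-- Dividing by `l₁` lowers the dimension by at most `l₁.length`, while the images of `l₂` still
generate the maximal ideal; the two bounds meet at `l₂.length`. -/
theorem isRegularLocalRing_quotient_ofList {R : Type*} [CommRing R] [IsRegularLocalRing R]
    (l₁ l₂ : List R) (h : Ideal.ofList (l₁ ++ l₂) = maximalIdeal R)
    (hlen : ringKrullDim R = ((l₁ ++ l₂).length : ℕ)) :
    IsRegularLocalRing (R ⧸ Ideal.ofList l₁) ∧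
      ringKrullDim (R ⧸ Ideal.ofList l₁) = (l₂.length : ℕ) := by
  classical
  have hle : Ideal.ofList l₁ ≤ maximalIdeal R := by
    rw [← h, Ideal.ofList_append]; exact le_sup_left
  have hne : Ideal.ofList l₁ ≠ ⊤ := fun e => (Ideal.IsPrime.ne_top inferInstance)
    (top_le_iff.mp (e ▸ hle))
  have : Nontrivial (R ⧸ Ideal.ofList l₁) := Ideal.Quotient.nontrivial_iff.mpr hne
  have hloc : IsLocalRing (R ⧸ Ideal.ofList l₁) :=
    IsLocalRing.of_surjective' (Ideal.Quotient.mk _) Ideal.Quotient.mk_surjective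
  have hmax : maximalIdeal (R ⧸ Ideal.ofList l₁) =
      Ideal.span ((l₂.map (Ideal.Quotient.mk (Ideal.ofList l₁))).toFinset : Set _) := by
    have h1 : (maximalIdeal R).map (Ideal.Quotient.mk (Ideal.ofList l₁)) =
        maximalIdeal (R ⧸ Ideal.ofList l₁) :=
      IsLocalRing.map_maximalIdeal_of_surjective _ Ideal.Quotient.mk_surjective
    rw [← h1, ← h, Ideal.ofList_append, Ideal.map_sup, Ideal.map_quotient_self, bot_sup_eq,
      Ideal.map_ofList]
    simp [Ideal.ofList]
  have hsp : (maximalIdeal (R ⧸ Ideal.ofList l₁)).spanFinrank ≤ l₂.length := by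
    rw [hmax]
    refine (Submodule.spanFinrank_span_le_ncard_of_finite (Finset.finite_toSet _)).trans ?_
    rw [Set.ncard_coe_finset]
    exact (List.toFinset_card_le _).trans (by simp)
  have hdim : ((l₂.length : ℕ) : WithBot ℕ∞) ≤ ringKrullDim (R ⧸ Ideal.ofList l₁) := by
    have h1 := ringKrullDim_le_ringKrullDim_quotient_add_card l₁.toFinset (by
      rw [IsLocalRing.ringJacobson_eq_maximalIdeal]
      intro x hx
      exact hle (Ideal.subset_span (by simpa using hx)))
    have h2 : Ideal.span (l₁.toFinset : Set R) = Ideal.ofList l₁ := by simp [Ideal.ofList]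
    rw [h2, hlen] at h1
    have h3 := (h1.trans (add_le_add_right (Nat.cast_le.mpr (List.toFinset_card_le l₁)) _))
    rw [List.length_append, Nat.cast_add, add_comm] at h3
    exact le_of_add_natCast_le_add_natCast h3
  have hreg : IsRegularLocalRing (R ⧸ Ideal.ofList l₁) :=
    IsRegularLocalRing.of_spanFinrank_maximalIdeal_le _
      ((Nat.cast_le.mpr hsp).trans hdim)
  refine ⟨hreg, le_antisymm ?_ hdim⟩
  rw [← hreg.spanFinrank_maximalIdeal]
  exact Nat.cast_le.mpr hsp

theorem exists_ofList_eq_maximalIdeal (R : Type*) [CommRing R] [IsRegularLocalRing R] :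
    ∃ l : List R, Ideal.ofList l = maximalIdeal R ∧ ringKrullDim R = (l.length : ℕ) := by
  obtain ⟨t, ht, hspan⟩ := Submodule.FG.exists_span_finset_card_eq_spanFinrank
    (IsNoetherian.noetherian (maximalIdeal R))
  refine ⟨t.toList, ?_, ?_⟩
  · rw [Ideal.ofList]
    simpa using hspan
  · rw [← IsRegularLocalRing.spanFinrank_maximalIdeal, ← ht]
    simp

/-- Exchange argument: an element outside 𝔪² has a unit coefficient on some parameter and can
replace it. -/
theorem exists_cons_ofList_eq_maximalIdeal {R : Type*} [CommRing R] [IsRegularLocalRing R]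
    {x : R} (hx : x ∈ maximalIdeal R) (hx2 : x ∉ maximalIdeal R ^ 2) :
    ∃ l : List R, Ideal.ofList (x :: l) = maximalIdeal R ∧
      ringKrullDim R = ((x :: l).length : ℕ) := by
  classical
  obtain ⟨l, hl, hdim⟩ := exists_ofList_eq_maximalIdeal R
  have hx' := hx
  rw [← hl, Ideal.ofList, show {r | r ∈ l} = (l.toFinset : Set R) by simp,
    Ideal.span, Submodule.mem_span_finset] at hx'
  obtain ⟨c, -, hc⟩ := hx'
  have hmem : ∀ i ∈ l, i ∈ maximalIdeal R := fun i hi => hl ▸ Ideal.subset_span hi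
  obtain ⟨i, hi, hci⟩ : ∃ i ∈ l.toFinset, IsUnit (c i) := by
    by_contra! hcon
    apply hx2
    rw [← hc, pow_two]
    exact Ideal.sum_mem _ fun i hi => Ideal.mul_mem_mul ((mem_maximalIdeal _).mpr (hcon i hi))
      (hmem i (by simpa using hi))
  have hil : i ∈ l := by simpa using hi
  have hperm := List.perm_cons_erase hil
  refine ⟨l.erase i, le_antisymm ?_ ?_, ?_⟩
  · rw [Ideal.ofList, Ideal.span_le]
    intro y hy
    rcases List.mem_cons.mp hy with rfl | hy
    · exact hx
    · exact hmem y (List.mem_of_mem_erase hy)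
  · rw [← hl, Ideal.ofList, Ideal.span_le]
    intro y hy
    rcases List.mem_cons.mp (hperm.subset hy) with rfl | hy
    · have h1 : c y * y = x - ∑ j ∈ l.toFinset.erase y, c j * j := by
        rw [← hc, ← Finset.add_sum_erase _ _ hi]; simp
      have h2 : c y * y ∈ Ideal.ofList (x :: l.erase y) := by
        rw [h1]
        refine Ideal.sub_mem _ (Ideal.subset_span (by simp)) (Ideal.sum_mem _ fun j hj => ?_)
        refine Ideal.mul_mem_left _ _ (Ideal.subset_span ?_)
        rw [Finset.mem_erase, List.mem_toFinset] at hj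
        exact List.mem_cons_of_mem _ ((List.mem_erase_of_ne hj.1).mpr hj.2)
      exact (Ideal.unit_mul_mem_iff_mem _ hci).mp h2
    · exact Ideal.subset_span (List.mem_cons_of_mem _ hy)
  · rw [hdim, hperm.length_eq]; simp

theorem isDomain_of_ringKrullDim_eq (n : ℕ) : ∀ (R : Type u) [CommRing R] [IsRegularLocalRing R],
    ringKrullDim R = n → IsDomain R := by
  induction n with
  | zero =>
    intro R _ _ h
    have h1 : (maximalIdeal R).spanFinrank = 0 := by
      have := IsRegularLocalRing.spanFinrank_maximalIdeal (R := R)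
      rw [h] at this
      exact_mod_cast this
    rw [Submodule.spanFinrank_eq_zero_iff_eq_bot (IsNoetherian.noetherian _)] at h1
    exact (IsLocalRing.isField_iff_maximalIdeal_eq.mpr h1).isDomain
  | succ n ih =>
    intro R _ _ h
    have hfin := minimalPrimes.finite_of_isNoetherianRing R
    have hspan : (maximalIdeal R).spanFinrank = n + 1 := by
      have := IsRegularLocalRing.spanFinrank_maximalIdeal (R := R)
      rw [h] at this
      exact_mod_cast this
    have hnot : ¬ ((maximalIdeal R : Set R) ⊆
        ⋃ i ∈ ((insert (maximalIdeal R ^ 2) hfin.toFinset : Finset (Ideal R)) : Set (Ideal R)),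
          (i : Set R)) := by
      classical
      -- Prime avoidance tolerates two ideals that need not be prime; 𝔪² is named for both, and the
      -- others are the minimal primes.
      rw [Ideal.subset_union_prime (f := fun i : Ideal R => i) (maximalIdeal R ^ 2)
        (maximalIdeal R ^ 2)]
      · rintro ⟨p, hp, hle⟩
        rcases Finset.mem_insert.mp hp with rfl | hp
        · have h1 : maximalIdeal R = ⊥ := by
            refine Submodule.eq_bot_of_le_smul_of_le_jacobson_bot (maximalIdeal R) _
              (IsNoetherian.noetherian _) ?_ (IsLocalRing.maximalIdeal_le_jacobson _)
            rwa [smul_eq_mul, ← pow_two]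
          rw [h1, Submodule.spanFinrank_bot] at hspan
          omega
        · have hp' : p ∈ minimalPrimes R := by simpa using hp
          have := hp'.isPrime
          have hpm : p = maximalIdeal R :=
            le_antisymm (IsLocalRing.le_maximalIdeal this.ne_top) hle
          have h0 : p.height = 0 := Ideal.height_eq_zero_iff.mpr hp'
          rw [hpm] at h0
          have := IsLocalRing.maximalIdeal_height_eq_ringKrullDim (R := R)
          rw [h0, h] at this
          exact absurd this (by norm_cast)
      · intro p hp hne _
        rcases Finset.mem_insert.mp hp with rfl | hp
        · exact absurd rfl hne
        · exact (by simpa using hp : p ∈ minimalPrimes R).isPrime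
    obtain ⟨x, hx, hxn⟩ := Set.not_subset.mp hnot
    simp only [Set.mem_iUnion, not_exists] at hxn
    have hx2 : x ∉ maximalIdeal R ^ 2 := fun hh => hxn _ (by simp) hh
    have hxp : ∀ p ∈ minimalPrimes R, x ∉ p := fun p hp hh => hxn p (by simp [hp]) hh
    obtain ⟨l, hl, hlen⟩ := exists_cons_ofList_eq_maximalIdeal hx hx2
    obtain ⟨hreg, hd⟩ := isRegularLocalRing_quotient_ofList [x] l hl hlen
    have hln : l.length = n := by
      rw [h] at hlen
      have : n + 1 = l.length + 1 := by exact_mod_cast hlen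
      omega
    have hdom := ih (R ⧸ Ideal.ofList [x]) (by rw [hd, hln])
    have hprime : (Ideal.ofList [x]).IsPrime := (Ideal.Quotient.isDomain_iff_prime _).mp hdom
    rw [Ideal.ofList_singleton] at hprime
    -- A minimal prime q inside the prime (x) does not contain x, so q = xq, and Nakayama gives q =
    -- 0.
    obtain ⟨q, hq, hqx⟩ := Ideal.exists_minimalPrimes_le (J := Ideal.span {x}) (bot_le)
    have hqp : q.IsPrime := hq.isPrime
    have hq0 : q = ⊥ := by
      refine Submodule.eq_bot_of_le_smul_of_le_jacobson_bot (maximalIdeal R) _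
        (IsNoetherian.noetherian _) ?_ (IsLocalRing.maximalIdeal_le_jacobson _)
      intro y hy
      obtain ⟨z, rfl⟩ := Ideal.mem_span_singleton.mp (hqx hy)
      have hz : z ∈ q := (hqp.mem_or_mem hy).resolve_left (hxp q hq)
      exact Ideal.mul_mem_mul hx hz
    rw [hq0] at hqp
    exact IsDomain.of_bot_isPrime R

theorem isDomain_of_isRegularLocalRing (R : Type u) [CommRing R] [IsRegularLocalRing R] :
    IsDomain R := by
  obtain ⟨l, -, h⟩ := exists_ofList_eq_maximalIdeal R
  exact isDomain_of_ringKrullDim_eq _ R h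

theorem isRegular_of_ofList_eq_maximalIdeal {R : Type u} [CommRing R] [IsRegularLocalRing R]
    {l : List R} (hl : Ideal.ofList l = maximalIdeal R) (hdim : ringKrullDim R = (l.length : ℕ)) :
    IsRegular R l := by
  refine ⟨⟨fun i hi => ?_⟩, ?_⟩
  · have key : ∀ j, IsRegularLocalRing (R ⧸ Ideal.ofList (l.take j)) ∧
        ringKrullDim (R ⧸ Ideal.ofList (l.take j)) = ((l.drop j).length : ℕ) := fun j =>
      isRegularLocalRing_quotient_ofList _ (l.drop j) (by rwa [List.take_append_drop])
        (by rwa [List.take_append_drop])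
    have := (key i).1
    have := isDomain_of_isRegularLocalRing (R ⧸ Ideal.ofList (l.take i))
    have hprime : (Ideal.ofList (l.take i)).IsPrime :=
      (Ideal.Quotient.isDomain_iff_prime _).mp this
    -- Otherwise two successive quotients would coincide, although their dimensions differ by one.
    have hnot : l[i] ∉ Ideal.ofList (l.take i) := by
      intro hmem
      have heq : Ideal.ofList (l.take (i + 1)) = Ideal.ofList (l.take i) := by
        rw [List.take_succ_eq_append_getElem hi, Ideal.ofList_append, Ideal.ofList_singleton,
          sup_eq_left, Ideal.span_singleton_le_iff_mem]
        exact hmem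
      have h1 := (key (i + 1)).2
      rw [heq, (key i).2] at h1
      have : (l.drop i).length = (l.drop (i + 1)).length := by exact_mod_cast h1
      simp only [List.length_drop] at this
      omega
    rw [isSMulRegular_quotient_iff_mem_of_smul_mem]
    intro y hy
    simp only [smul_eq_mul, Ideal.mul_top] at hy ⊢
    exact (hprime.mem_or_mem hy).resolve_left hnot
  · rw [hl, smul_eq_mul, Ideal.mul_top]
    exact (Ideal.IsPrime.ne_top inferInstance).symm

end RegularLocal

/-! ### Projective dimension in short exact sequences. -/

section ProjectiveDimension

open CategoryTheory

variable {R : Type u} [CommRing R]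

/-- The projective dimension of the `R`-module `M` is less than `n`. -/
abbrev ProjDimLT (R : Type u) [CommRing R] (M : Type u) [AddCommGroup M] [Module R M] (n : ℕ) :
    Prop :=
  HasProjectiveDimensionLT (ModuleCat.of R M) n

variable {M N P : Type u} [AddCommGroup M] [Module R M] [AddCommGroup N] [Module R N]
  [AddCommGroup P] [Module R P]

theorem ProjDimLT.mono {m n : ℕ} (h : ProjDimLT R M m) (hmn : m ≤ n) : ProjDimLT R M n :=
  hasProjectiveDimensionLT_of_ge _ m n hmn

theorem ProjDimLT.of_linearEquiv {n : ℕ} (h : ProjDimLT R M n) (e : M ≃ₗ[R] N) :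
    ProjDimLT R N n :=
  hasProjectiveDimensionLT_of_iso e.toModuleIso n

theorem projDimLT_zero_iff : ProjDimLT R M 0 ↔ Subsingleton M := by
  rw [ProjDimLT, hasProjectiveDimensionLT_zero_iff_isZero, ModuleCat.isZero_iff_subsingleton]

theorem projDimLT_of_subsingleton [Subsingleton M] (n : ℕ) : ProjDimLT R M n :=
  (projDimLT_zero_iff.mpr inferInstance).mono (Nat.zero_le n)

theorem projDimLT_one_of_projective [Module.Projective R M] : ProjDimLT R M 1 := by
  have : Projective (ModuleCat.of R M) := (IsProjective.iff_projective _).mp inferInstance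
  infer_instance

variable {f : M →ₗ[R] N} {g : N →ₗ[R] P}

theorem shortExact_of_exact (hf : Function.Injective f) (hg : Function.Surjective g)
    (hfg : Function.Exact f g) :
    (ModuleCat.shortComplexOfCompEqZero f g hfg.linearMap_comp_eq_zero).ShortExact :=
  ModuleCat.shortComplex_shortExact _ hfg hf hg

theorem ProjDimLT.middle (hf : Function.Injective f) (hg : Function.Surjective g)
    (hfg : Function.Exact f g) {n : ℕ} (h₁ : ProjDimLT R M n) (h₃ : ProjDimLT R P n) :
    ProjDimLT R N n :=
  (shortExact_of_exact hf hg hfg).hasProjectiveDimensionLT_X₂ n h₁ h₃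

theorem ProjDimLT.right (hf : Function.Injective f) (hg : Function.Surjective g)
    (hfg : Function.Exact f g) {n : ℕ} (h₁ : ProjDimLT R M n) (h₂ : ProjDimLT R N (n + 1)) :
    ProjDimLT R P (n + 1) :=
  (shortExact_of_exact hf hg hfg).hasProjectiveDimensionLT_X₃ n h₁ h₂

theorem ProjDimLT.left (hf : Function.Injective f) (hg : Function.Surjective g)
    (hfg : Function.Exact f g) {n : ℕ} (h₂ : ProjDimLT R N n) (h₃ : ProjDimLT R P (n + 1)) :
    ProjDimLT R M n :=
  (shortExact_of_exact hf hg hfg).hasProjectiveDimensionLT_X₁ n h₂ h₃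

theorem ProjDimLT.quotient (L : Submodule R M) {n : ℕ} (h₁ : ProjDimLT R L n)
    (h₂ : ProjDimLT R M (n + 1)) : ProjDimLT R (M ⧸ L) (n + 1) :=
  ProjDimLT.right L.injective_subtype L.mkQ_surjective (LinearMap.exact_subtype_mkQ L) h₁ h₂

theorem ProjDimLT.prod {n : ℕ} (h₁ : ProjDimLT R M n) (h₂ : ProjDimLT R N n) :
    ProjDimLT R (M × N) n :=
  ProjDimLT.middle (f := LinearMap.inl R M N) (g := LinearMap.snd R M N) LinearMap.inl_injective
    LinearMap.snd_surjective Function.Exact.inl_snd h₁ h₂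

theorem ProjDimLT.pi_fin {n : ℕ} (h : ProjDimLT R M n) (k : ℕ) : ProjDimLT R (Fin k → M) n := by
  induction k with
  | zero => exact projDimLT_of_subsingleton n
  | succ k ih => exact (h.prod ih).of_linearEquiv (Fin.consLinearEquiv R fun _ => M)

theorem ProjDimLT.pi {n : ℕ} (h : ProjDimLT R M n) (ι : Type*) [Finite ι] :
    ∀ {N : Type u} [AddCommGroup N] [Module R N], (N ≃ₗ[R] (ι → M)) → ProjDimLT R N n := by
  intro N _ _ e
  exact (h.pi_fin (Nat.card ι)).of_linearEquiv
    ((LinearEquiv.funCongrLeft R M (Finite.equivFin ι)).trans e.symm)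

end ProjectiveDimension

/-! ### Global dimension, and heights of associated primes. -/

section RegularLocal

open CategoryTheory

variable {R : Type u} [CommRing R] {M : Type u} [AddCommGroup M] [Module R M]

theorem add_one_lt_natCast_add_one_iff {a : WithBot ℕ∞} {n : ℕ} :
    a + 1 < ((n + 1 : ℕ) : WithBot ℕ∞) ↔ a < n := by
  induction a with
  | bot =>
    rw [WithBot.bot_add]
    exact ⟨fun _ => WithBot.bot_lt_coe _, fun _ => WithBot.bot_lt_coe _⟩
  | coe a =>
    induction a with
    | top =>
      refine ⟨fun h => absurd h ?_, fun h => absurd h ?_⟩ <;> exact not_lt_of_ge le_top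
    | coe a => norm_cast; omega

theorem projDimLT_quotSMulTop_iff [IsLocalRing R] [IsNoetherianRing R] [Module.Finite R M] {x : R}
    (hx : x ∈ maximalIdeal R) (hreg : IsSMulRegular M x) {n : ℕ} :
    ProjDimLT R (QuotSMulTop x M) (n + 1) ↔ ProjDimLT R M n := by
  rw [ProjDimLT, ProjDimLT, ← projectiveDimension_lt_iff, ← projectiveDimension_lt_iff,
    ModuleCat.projectiveDimension_quotSMulTop_eq_succ_of_isSMulRegular (ModuleCat.of R M) x hreg hx,
    add_one_lt_natCast_add_one_iff]

/-- The half of Auslander–Buchsbaum that is needed: each regular element lowers the uniform bound by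
one. The subtraction is truncated, and the bound 0 means that the module vanishes. -/
theorem projDimLT_of_isWeaklyRegular [IsLocalRing R] [IsNoetherianRing R] {d : ℕ}
    (hd : ∀ (N : Type u) [AddCommGroup N] [Module R N] [Module.Finite R N],
      ProjDimLT R N (d + 1))
    {M : Type u} [AddCommGroup M] [Module R M] [Module.Finite R M] {l : List R}
    (hl : IsWeaklyRegular M l) (hmem : ∀ x ∈ l, x ∈ maximalIdeal R) :
    ProjDimLT R M (d + 1 - l.length) := by
  induction l generalizing M with
  | nil => exact hd M
  | cons x l ih =>
    rw [isWeaklyRegular_cons_iff] at hl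
    have h1 := ih hl.2 (fun y hy => hmem y (List.mem_cons_of_mem _ hy))
    have h2 : ProjDimLT R M (d + 1 - l.length - 1) := by
      refine (projDimLT_quotSMulTop_iff (hmem x (by simp)) hl.1).mp (h1.mono (by omega))
    exact h2.mono (by simp; omega)

theorem projectiveDimension_residueField [IsRegularLocalRing R] :
    projectiveDimension (ModuleCat.of R (R ⧸ maximalIdeal R)) = ringKrullDim R := by
  obtain ⟨l, hl, hd⟩ := exists_ofList_eq_maximalIdeal R
  have hreg := isRegular_of_ofList_eq_maximalIdeal hl hd
  have h1 := ModuleCat.projectiveDimension_quotient_eq_add_length_of_isWeaklyRegular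
    (ModuleCat.of R R) l hreg.1 (fun x hx => hl ▸ Ideal.subset_span hx)
  have h2 : projectiveDimension (ModuleCat.of R R) = 0 := by
    have : Projective (ModuleCat.of R R) := (IsProjective.iff_projective _).mp inferInstance
    exact ModuleCat.projectiveDimension_eq_zero_of_projective _
  rw [h2, zero_add, ← hd] at h1
  rw [← h1]
  refine projectiveDimension_eq_of_iso (LinearEquiv.toModuleIso ?_)
  exact Submodule.quotEquivOfEq _ _ (by rw [hl]; simp)

/-- Noetherian induction on the annihilating ideal, with a filtration by modules R/p. For p ≠ 𝔪, an
x in 𝔪 outside p is regular on R/p, and (R/p)/x has a strictly larger annihilator. -/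
theorem projDimLT_of_annihilator [IsRegularLocalRing R] {d : ℕ} (hd : ringKrullDim R = d)
    (I : Ideal R) : ∀ (N : Type u) [AddCommGroup N] [Module R N] [Module.Finite R N],
      I ≤ Module.annihilator R N → ProjDimLT R N (d + 1) := by
  induction I using IsNoetherian.induction with
  | hgt I ih =>
    intro N _ _ hfin
    induction hfin using IsNoetherianRing.induction_on_isQuotientEquivQuotientPrime R with
    | subsingleton N => exact fun _ => projDimLT_of_subsingleton _
    | quotient N p e =>
      intro hI
      have hp := p.2
      rw [e.annihilator_eq, Ideal.annihilator_quotient] at hI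
      suffices h : ProjDimLT R (R ⧸ p.1) (d + 1) from h.of_linearEquiv e.symm
      by_cases hpm : p.1 = maximalIdeal R
      · rw [hpm, ProjDimLT, ← projectiveDimension_lt_iff, projectiveDimension_residueField, hd]
        exact_mod_cast Nat.lt_succ_self d
      · have hlt := lt_of_le_of_ne (IsLocalRing.le_maximalIdeal hp.ne_top) hpm
        obtain ⟨x, hx, hxp⟩ := SetLike.exists_of_lt hlt
        have hreg : IsSMulRegular (R ⧸ p.1) x := by
          rw [isSMulRegular_quotient_iff_mem_of_smul_mem]
          exact fun y hy => (hp.mem_or_mem hy).resolve_left hxp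
        refine ((projDimLT_quotSMulTop_iff hx hreg).mp ?_ : ProjDimLT R _ d).mono (Nat.le_succ d)
        refine ih (p.1 ⊔ Ideal.span {x}) ?_ (QuotSMulTop x (R ⧸ p.1)) ?_
        · refine lt_of_le_of_lt hI (lt_of_le_of_ne le_sup_left fun h => hxp ?_)
          rw [h]
          exact Ideal.mem_sup_right (Ideal.mem_span_singleton_self x)
        · refine sup_le ?_ ?_
          · intro a ha
            rw [Module.mem_annihilator]
            intro m
            obtain ⟨m, rfl⟩ := Submodule.Quotient.mk_surjective _ m
            have : a • m = 0 := by
              have h1 : a ∈ Module.annihilator R (R ⧸ p.1) := by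
                rwa [Ideal.annihilator_quotient]
              exact Module.mem_annihilator.mp h1 m
            rw [← Submodule.Quotient.mk_smul, this, Submodule.Quotient.mk_zero]
          · rw [Ideal.span_singleton_le_iff_mem, Module.mem_annihilator]
            intro m
            obtain ⟨m, rfl⟩ := Submodule.Quotient.mk_surjective _ m
            rw [← Submodule.Quotient.mk_smul, Submodule.Quotient.mk_eq_zero]
            exact Submodule.smul_mem_pointwise_smul _ _ _ trivial
    | exact N₁ N₂ N₃ f g hf hg hfg h₁ h₃ =>
      intro hI
      exact ProjDimLT.middle hf hg hfg (h₁ (hI.trans (f.annihilator_le_of_injective hf)))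
        (h₃ (hI.trans (g.annihilator_le_of_surjective hg)))

/-- The global dimension of a regular local ring is at most its Krull dimension. -/
theorem projDimLT_ringKrullDim_add_one [IsRegularLocalRing R] {d : ℕ} (hd : ringKrullDim R = d)
    (N : Type u) [AddCommGroup N] [Module R N] [Module.Finite R N] : ProjDimLT R N (d + 1) :=
  projDimLT_of_annihilator hd ⊥ N bot_le

theorem exists_isAssociatedPrime_quotSMulTop [IsLocalRing R] [IsNoetherianRing R]
    [Module.Finite R M] {p : Ideal R} (hp : IsAssociatedPrime p M) {x : R}
    (hx : x ∈ maximalIdeal R) (hreg : IsSMulRegular M x) :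
    ∃ q : Ideal R, IsAssociatedPrime q (QuotSMulTop x M) ∧ p < q := by
  obtain ⟨hprime, y, hy⟩ := isAssociatedPrime_iff.mp hp
  have hxp : x ∉ p := by
    intro h
    rw [hy, Submodule.mem_colon_singleton, Submodule.mem_bot] at h
    have : y = 0 := hreg.right_eq_zero_of_smul h
    apply hprime.ne_top
    rw [hy, this]
    simp
  let U : Submodule R M := Submodule.torsionBySet R M p
  have hU : ∀ n : M, n ∈ U ↔ ∀ a ∈ p, a • n = 0 := fun n => by
    simp [U, Submodule.mem_torsionBySet_iff]
  have hyU : y ∈ U := by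
    rw [hU]
    intro a ha
    rw [hy, Submodule.mem_colon_singleton, Submodule.mem_bot] at ha
    exact ha
  -- If the elements U killed by p all lay in xM, regularity of x would give U = xU, and Nakayama
  -- would give U = 0, although y is in U.
  obtain ⟨u, huU, hu⟩ : ∃ u ∈ U, u ∉ x • (⊤ : Submodule R M) := by
    by_contra! hcon
    have hU0 : U = ⊥ := by
      refine Submodule.eq_bot_of_le_smul_of_le_jacobson_bot (maximalIdeal R) _
        (IsNoetherian.noetherian _) ?_ (IsLocalRing.maximalIdeal_le_jacobson _)
      intro n hn
      obtain ⟨m, -, hm⟩ := (Submodule.mem_smul_pointwise_iff_exists _ _ _).mp (hcon n hn)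
      rw [← hm]
      refine Submodule.smul_mem_smul hx ?_
      rw [hU]
      intro a ha
      refine hreg.right_eq_zero_of_smul ?_
      rw [smul_comm, hm]
      exact (hU n).mp hn a ha
    rw [hU0, Submodule.mem_bot] at hyU
    apply hprime.ne_top
    rw [hy, hyU]
    simp
  have hu0 : (Submodule.Quotient.mk u : QuotSMulTop x M) ≠ 0 := by
    rwa [Ne, Submodule.Quotient.mk_eq_zero]
  obtain ⟨q, hq, hle⟩ := exists_le_isAssociatedPrime_of_isNoetherianRing R _ hu0
  refine ⟨q, hq, lt_of_le_of_ne (fun a ha => hle ?_) fun h => hxp ?_⟩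
  · rw [Submodule.mem_colon_singleton, Submodule.mem_bot, ← Submodule.Quotient.mk_smul,
      (hU u).mp huU a ha, Submodule.Quotient.mk_zero]
  · rw [h]
    refine hle ?_
    rw [Submodule.mem_colon_singleton, Submodule.mem_bot, ← Submodule.Quotient.mk_smul,
      Submodule.Quotient.mk_eq_zero]
    exact Submodule.smul_mem_pointwise_smul _ _ _ trivial

/-- Induction from larger primes to smaller ones. If 𝔪 is associated, R/𝔪 embeds in N, and pd R/𝔪 =
dim R forces n > dim R. Otherwise divide by an N-regular x in 𝔪: the projective dimension rises by
one, and p is strictly contained in an associated prime of the quotient. -/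
theorem height_lt_of_isAssociatedPrime [IsRegularLocalRing R] (p : Ideal R) :
    ∀ (N : Type u) [AddCommGroup N] [Module R N] [Module.Finite R N] (n : ℕ),
      IsAssociatedPrime p N → ProjDimLT R N n → p.height < n := by
  obtain ⟨l, -, hd⟩ := exists_ofList_eq_maximalIdeal R
  generalize l.length = d at hd
  induction p using IsNoetherian.induction with
  | hgt p ih =>
    change Ideal R at p
    intro N _ _ _ n hp hn
    have hprime := hp.isPrime
    by_cases hm : IsAssociatedPrime (maximalIdeal R) N
    · have hpd : Ideal.height p ≤ d := by
        have := Ideal.height_le_ringKrullDim_of_isPrime (I := p)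
        rw [hd] at this
        exact_mod_cast this
      refine lt_of_le_of_lt hpd ?_
      by_contra! hnd
      have hnd : n ≤ d := by exact_mod_cast hnd
      obtain ⟨-, f, hf⟩ :=
        (isAssociatedPrime_iff_exists_injective_linearMap _ _).mp hm
      have h1 : ProjDimLT R (R ⧸ maximalIdeal R) d :=
        ProjDimLT.left hf (Submodule.mkQ_surjective (LinearMap.range f))
          (LinearMap.exact_map_mkQ_range f) (hn.mono hnd) (projDimLT_ringKrullDim_add_one hd _)
      rw [ProjDimLT, ← projectiveDimension_lt_iff, projectiveDimension_residueField, hd] at h1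
      exact lt_irrefl _ h1
    · have hnot : ¬ (maximalIdeal R : Set R) ⊆ ⋃ q ∈ associatedPrimes R N, (q : Set R) := by
        rw [Ideal.subset_union_prime_finite (associatedPrimes.finite R N) (f := fun q : Ideal R => q) ⊥ ⊥
          (fun q hq _ _ => hq.isPrime)]
        rintro ⟨q, hq, hle⟩
        have := (IsAssociatedPrime.isPrime hq)
        rw [le_antisymm hle (IsLocalRing.le_maximalIdeal this.ne_top)] at hm
        exact hm hq
      rw [biUnion_associatedPrimes_eq_compl_regular] at hnot
      obtain ⟨x, hx, hreg⟩ := Set.not_subset.mp hnot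
      have hreg : IsSMulRegular N x := by simpa using hreg
      obtain ⟨q, hq, hpq⟩ := exists_isAssociatedPrime_quotSMulTop hp hx hreg
      have := hq.isPrime
      have h1 := ih q hpq (QuotSMulTop x N) (n + 1) hq
        ((projDimLT_quotSMulTop_iff hx hreg).mpr hn)
      have h2 := Ideal.height_add_one_le_of_lt_of_isPrime hpq
      have h3 := lt_of_le_of_lt h2 h1
      rw [Nat.cast_add, Nat.cast_one] at h3
      exact lt_of_add_lt_add_right h3

/-- A nonzero element of a finite module that is killed by an ideal bounds the height of that
ideal by the projective dimension. -/
theorem eq_zero_of_projDimLT [IsRegularLocalRing R] {N : Type u} [AddCommGroup N] [Module R N]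
    [Module.Finite R N] {n : ℕ} (hn : ProjDimLT R N n) {b : Ideal R} (hb : (n : ℕ∞) ≤ b.height)
    {y : N} (hy : ∀ a ∈ b, a • y = 0) : y = 0 := by
  by_contra hy0
  obtain ⟨p, hp, hle⟩ := exists_le_isAssociatedPrime_of_isNoetherianRing R y hy0
  have h1 : b ≤ p := fun a ha => hle (by
    rw [Submodule.mem_colon_singleton, Submodule.mem_bot]; exact hy a ha)
  exact absurd (height_lt_of_isAssociatedPrime p N n hp hn)
    (not_lt_of_ge (hb.trans (Ideal.height_mono h1)))

/-- An associated prime of the cyclic module Ry contains a power of each element of b, hence b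
itself; it is the annihilator of some multiple cy. -/
theorem exists_smul_ne_zero_of_pow_smul_eq_zero [IsNoetherianRing R] {N : Type u} [AddCommGroup N]
    [Module R N] {b : Ideal R} {y : N} (hy : y ≠ 0) (hb : ∀ a ∈ b, ∃ k : ℕ, a ^ k • y = 0) :
    ∃ c : R, c • y ≠ 0 ∧ ∀ a ∈ b, a • c • y = 0 := by
  obtain ⟨p, hp, hle⟩ := exists_le_isAssociatedPrime_of_isNoetherianRing R
    (M := Submodule.span R {y}) ⟨y, Submodule.mem_span_singleton_self y⟩ (by simpa using hy)
  obtain ⟨hprime, ⟨z, hz⟩, hpz⟩ := isAssociatedPrime_iff.mp hp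
  obtain ⟨c, rfl⟩ := Submodule.mem_span_singleton.mp hz
  refine ⟨c, fun h0 => hprime.ne_top ?_, fun a ha => ?_⟩
  · rw [hpz]
    ext r
    simp [Submodule.mem_colon_singleton, h0]
  · obtain ⟨k, hk⟩ := hb a ha
    have h1 : a ^ k ∈ p := hle (by
      rw [Submodule.mem_colon_singleton, Submodule.mem_bot]
      exact Subtype.ext hk)
    have h2 := hprime.mem_of_pow_mem k h1
    rw [hpz, Submodule.mem_colon_singleton, Submodule.mem_bot] at h2
    exact congrArg Subtype.val h2

theorem eq_zero_of_projDimLT_of_pow [IsRegularLocalRing R] {N : Type u} [AddCommGroup N]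
    [Module R N] [Module.Finite R N] {n : ℕ} (hn : ProjDimLT R N n) {b : Ideal R}
    (hb : (n : ℕ∞) ≤ b.height) {y : N} (hy : ∀ a ∈ b, ∃ k : ℕ, a ^ k • y = 0) : y = 0 := by
  by_contra hy0
  obtain ⟨c, hc, hbc⟩ := exists_smul_ne_zero_of_pow_smul_eq_zero hy0 hy
  exact hc (eq_zero_of_projDimLT hn hb hbc)

end RegularLocal

/-! ### Grade, perfection, and depth versus projective dimension. -/

section Perfect

open CategoryTheory

variable {R : Type u} [CommRing R]

theorem projDimLT_quotient_ofList [IsLocalRing R] [IsNoetherianRing R] {l : List R}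
    (hl : IsWeaklyRegular R l) (hmem : ∀ x ∈ l, x ∈ maximalIdeal R) :
    ProjDimLT R (R ⧸ (Ideal.ofList l • ⊤ : Submodule R R)) (l.length + 1) := by
  have h1 := ModuleCat.projectiveDimension_quotient_eq_add_length_of_isWeaklyRegular
    (ModuleCat.of R R) l hl hmem
  have h2 : projectiveDimension (ModuleCat.of R R) = 0 := by
    have : Projective (ModuleCat.of R R) := (IsProjective.iff_projective _).mp inferInstance
    exact ModuleCat.projectiveDimension_eq_zero_of_projective _
  rw [h2, zero_add] at h1
  exact (projectiveDimension_le_iff _ _).mp h1.le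

theorem exists_isSMulRegular_of_height [IsRegularLocalRing R] {K : Ideal R} {N : Type u}
    [AddCommGroup N] [Module R N] [Module.Finite R N] {n : ℕ} (hN : ProjDimLT R N n)
    (hK : (n : ℕ∞) ≤ K.height) : ∃ x ∈ K, IsSMulRegular N x := by
  have hnot : ¬ (K : Set R) ⊆ ⋃ q ∈ associatedPrimes R N, (q : Set R) := by
    rw [Ideal.subset_union_prime_finite (associatedPrimes.finite R N) (f := fun q : Ideal R => q)
      ⊥ ⊥ (fun q hq _ _ => hq.isPrime)]
    rintro ⟨q, hq, hle⟩
    exact absurd (height_lt_of_isAssociatedPrime q N n hq hN)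
      (not_lt_of_ge (hK.trans (Ideal.height_mono hle)))
  rw [biUnion_associatedPrimes_eq_compl_regular] at hnot
  obtain ⟨x, hx, hreg⟩ := Set.not_subset.mp hnot
  exact ⟨x, hx, by simpa using hreg⟩

theorem exists_isWeaklyRegular_of_le_height [IsRegularLocalRing R] {K : Ideal R} (hK : K ≠ ⊤)
    {s : ℕ} (hs : (s : ℕ∞) ≤ K.height) (i : ℕ) (hi : i ≤ s) :
    ∃ l : List R, (∀ x ∈ l, x ∈ K) ∧ IsWeaklyRegular R l ∧ l.length = i := by
  induction i with
  | zero => exact ⟨[], by simp, IsWeaklyRegular.nil R R, rfl⟩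
  | succ i ih =>
    obtain ⟨l, hlK, hl, hlen⟩ := ih (by omega)
    have h1 := projDimLT_quotient_ofList hl (fun x hx => IsLocalRing.le_maximalIdeal hK (hlK x hx))
    rw [hlen] at h1
    obtain ⟨x, hx, hreg⟩ := exists_isSMulRegular_of_height h1
      ((Nat.cast_le.mpr hi).trans hs)
    refine ⟨l ++ [x], ?_, ?_, by simp [hlen]⟩
    · intro y hy
      rcases List.mem_append.mp hy with hy | hy
      · exact hlK y hy
      · rw [List.mem_singleton.mp hy]; exact hx
    · rw [isWeaklyRegular_append_iff, isWeaklyRegular_singleton_iff]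
      exact ⟨hl, hreg⟩

theorem length_le_height_of_isWeaklyRegular [IsNoetherianRing R] {l : List R}
    (hl : IsWeaklyRegular R l) {p : Ideal R} [p.IsPrime] (hlp : ∀ x ∈ l, x ∈ p) :
    (l.length : ℕ∞) ≤ p.height := by
  have h1 := hl.isRegular_of_isLocalization_of_mem (S := Localization.AtPrime p) p hlp
  have h2 := ringKrullDim_add_length_eq_ringKrullDim_of_isRegular _ h1
  have hnt : Nontrivial (Localization.AtPrime p ⧸
      Ideal.ofList (l.map (algebraMap R (Localization.AtPrime p)))) :=
    Ideal.Quotient.nontrivial_iff.mpr fun h => h1.top_ne_smul (by rw [h]; simp)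
  rw [IsLocalization.AtPrime.ringKrullDim_eq_height p (Localization.AtPrime p)] at h2
  have h3 : ((l.length : ℕ) : WithBot ℕ∞) ≤ (p.height : WithBot ℕ∞) := by
    rw [← h2]
    simpa using le_add_of_nonneg_left (ringKrullDim_nonneg_of_nontrivial
      (R := Localization.AtPrime p ⧸ Ideal.ofList (l.map (algebraMap R (Localization.AtPrime p)))))
  exact_mod_cast h3

/-- An associated prime of R/K has height at most s and bounds the length of regular sequences in K.
If pd R/K were < s, the element 1 of R/K, killed by K with ht K ≥ s, would be zero. -/
theorem isPerfect_and_grade_eq [IsRegularLocalRing R] {K : Ideal R} (hK : K ≠ ⊤) {s : ℕ}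
    (hs : (s : ℕ∞) ≤ K.height) (hpd : ProjDimLT R (R ⧸ K) (s + 1)) :
    IsPerfect K ∧ grade K = (s : ℕ∞) := by
  have hnt : Nontrivial (R ⧸ K) := Ideal.Quotient.nontrivial_iff.mpr hK
  have hgrade : grade K = (s : ℕ∞) := by
    refine le_antisymm (iSup₂_le fun l hl => ?_) ?_
    · obtain ⟨p, hp⟩ := associatedPrimes.nonempty R (R ⧸ K)
      have hprime := IsAssociatedPrime.isPrime hp
      have hKp : K ≤ p := by
        have := IsAssociatedPrime.annihilator_le hp
        rwa [Submodule.annihilator_top, Ideal.annihilator_quotient] at this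
      have h1 := height_lt_of_isAssociatedPrime p _ _ hp hpd
      have h2 := length_le_height_of_isWeaklyRegular hl.2 (p := p) (fun x hx => hKp (hl.1 x hx))
      have h3 := h2.trans_lt h1
      have h4 : l.length < s + 1 := by exact_mod_cast h3
      exact_mod_cast Nat.le_of_lt_succ h4
    · obtain ⟨l, hlK, hl, hlen⟩ := exists_isWeaklyRegular_of_le_height hK hs s le_rfl
      rw [← hlen]
      exact le_iSup₂_of_le (f := fun (xs : List R)
        (_ : (∀ x ∈ xs, x ∈ K) ∧ IsWeaklyRegular R xs) => (xs.length : ℕ∞)) l ⟨hlK, hl⟩ le_rfl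
  refine ⟨⟨hK, ?_⟩, hgrade⟩
  rw [hgrade]
  refine le_antisymm ((projectiveDimension_le_iff _ s).mpr hpd)
    ((projectiveDimension_ge_iff _ s).mpr fun h => ?_)
  have h1 : (1 : R ⧸ K) = 0 := by
    refine eq_zero_of_projDimLT h hs fun a ha => ?_
    rw [Algebra.smul_def, mul_one]
    exact Ideal.Quotient.eq_zero_iff_mem.mpr ha
  exact one_ne_zero h1

theorem projDimLT_of_le_depth [IsRegularLocalRing R] {H : Type u} [AddCommGroup H] [Module R H]
    [Module.Finite R H] {n i : ℕ} (hi : i ≤ n)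
    (h : ringKrullDim R + (i : WithBot ℕ∞) ≤ ((depth R H + (n : ℕ∞) : ℕ∞) : WithBot ℕ∞)) :
    ProjDimLT R H (n - i + 1) := by
  obtain ⟨l, -, hd⟩ := exists_ofList_eq_maximalIdeal R
  generalize l.length = d at hd
  have hgl : ∀ (N : Type u) [AddCommGroup N] [Module R N] [Module.Finite R N],
      ProjDimLT R N (d + 1) := fun N => projDimLT_ringKrullDim_add_one hd N
  by_cases hdn : d + i ≤ n
  · exact (hgl H).mono (by omega)
  rw [hd] at h
  have h1 : ((d + i : ℕ) : ℕ∞) ≤ depth R H + n := by exact_mod_cast h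
  -- The supremum need not be known to be attained: a strict inequality one below the target still
  -- yields a sequence of length at least d + i - n.
  have h2 : ((d + i - n - 1 : ℕ) : ℕ∞) < depth R H := by
    by_contra! hcon
    have h3 := h1.trans (add_le_add_left hcon (n : ℕ∞))
    have h4 : d + i ≤ d + i - n - 1 + n := by exact_mod_cast h3
    omega
  rw [depth, moduleGrade, lt_iSup_iff] at h2
  obtain ⟨xs, h2⟩ := h2
  rw [lt_iSup_iff] at h2
  obtain ⟨hxs, h2⟩ := h2
  have h5 : d + i - n - 1 < xs.length := by exact_mod_cast h2
  exact (projDimLT_of_isWeaklyRegular hgl hxs.2 hxs.1).mono (by omega)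

end Perfect

/-! ### Contraction calculus in the exterior algebra. -/

section Contraction

variable {R : Type*} [CommRing R] {V : Type*} [AddCommGroup V] [Module R V]
  {V' : Type*} [AddCommGroup V'] [Module R V']

/-- Contraction of the exterior algebra with a linear form. -/
def contract (d : Module.Dual R V) : ExteriorAlgebra R V →ₗ[R] ExteriorAlgebra R V :=
  CliffordAlgebra.contractLeft d

theorem contract_ι_mul (d : Module.Dual R V) (v : V) (x : ExteriorAlgebra R V) :
    contract d (ExteriorAlgebra.ι R v * x) =
      d v • x - ExteriorAlgebra.ι R v * contract d x :=
  CliffordAlgebra.contractLeft_ι_mul _ v x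

theorem contract_algebraMap (d : Module.Dual R V) (a : R) :
    contract d (algebraMap R _ a) = 0 :=
  CliffordAlgebra.contractLeft_algebraMap (Q := 0) d a

theorem contract_comm (d d' : Module.Dual R V) (x : ExteriorAlgebra R V) :
    contract d (contract d' x) = -contract d' (contract d x) :=
  CliffordAlgebra.contractLeft_comm (d := d) d' x

theorem contract_contract (d : Module.Dual R V) (x : ExteriorAlgebra R V) :
    contract d (contract d x) = 0 :=
  CliffordAlgebra.contractLeft_contractLeft _ x

theorem contract_add (d d' : Module.Dual R V) (x : ExteriorAlgebra R V) :
    contract (d + d') x = contract d x + contract d' x := by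
  simp [contract]

theorem contract_zero (x : ExteriorAlgebra R V) : contract (0 : Module.Dual R V) x = 0 := by
  simp [contract]

theorem contract_smul (a : R) (d : Module.Dual R V) (x : ExteriorAlgebra R V) :
    contract (a • d) x = a • contract d x := by
  simp [contract]

theorem contract_sum {κ : Type*} (t : Finset κ) (d : κ → Module.Dual R V)
    (x : ExteriorAlgebra R V) : contract (∑ j ∈ t, d j) x = ∑ j ∈ t, contract (d j) x := by
  simp [contract]

theorem mem_exteriorPower_zero_iff {x : ExteriorAlgebra R V} :
    x ∈ ⋀[R]^0 V ↔ ∃ a : R, algebraMap R _ a = x := by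
  rw [ExteriorAlgebra.exteriorPower, pow_zero, Submodule.mem_one]

theorem ι_mul_mem {i : ℕ} (v : V) {x : ExteriorAlgebra R V} (hx : x ∈ ⋀[R]^i V) :
    ExteriorAlgebra.ι R v * x ∈ ⋀[R]^(i + 1) V := by
  rw [ExteriorAlgebra.exteriorPower, pow_succ']
  exact Submodule.mul_mem_mul (LinearMap.mem_range_self _ v) hx

theorem exteriorPower_induction {p : ℕ → ExteriorAlgebra R V → Prop}
    (algebraMap : ∀ a : R, p 0 (algebraMap R _ a))
    (ι_mul : ∀ (i : ℕ) (v : V) (x : ExteriorAlgebra R V), x ∈ ⋀[R]^i V → p i x →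
      p (i + 1) (ExteriorAlgebra.ι R v * x))
    (add : ∀ (i : ℕ) (x y : ExteriorAlgebra R V), p i x → p i y → p i (x + y))
    (i : ℕ) {x : ExteriorAlgebra R V} (hx : x ∈ ⋀[R]^i V) : p i x := by
  induction i generalizing x with
  | zero =>
    obtain ⟨a, rfl⟩ := mem_exteriorPower_zero_iff.mp hx
    exact algebraMap a
  | succ i ih =>
    rw [ExteriorAlgebra.exteriorPower, pow_succ'] at hx
    induction hx using Submodule.mul_induction_on' with
    | mem_mul_mem a ha b hb =>
      obtain ⟨v, rfl⟩ := ha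
      exact ι_mul i v b hb (ih hb)
    | add a _ b _ ha hb => exact add _ a b ha hb

theorem exteriorAlgebra_induction {p : ExteriorAlgebra R V → Prop}
    (algebraMap : ∀ a : R, p (algebraMap R _ a))
    (ι_mul : ∀ (v : V) (x : ExteriorAlgebra R V), p x → p (ExteriorAlgebra.ι R v * x))
    (add : ∀ (x y : ExteriorAlgebra R V), p x → p y → p (x + y))
    (x : ExteriorAlgebra R V) : p x := by
  classical
  rw [← DirectSum.sum_support_decompose (fun n : ℕ => ⋀[R]^n V) x]
  refine Finset.sum_induction _ p add (by simpa using algebraMap 0) fun i _ => ?_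
  exact exteriorPower_induction (p := fun _ x => p x) algebraMap (fun _ v x _ => ι_mul v x)
    (fun _ => add) i (SetLike.coe_mem _)

theorem contract_mem (d : Module.Dual R V) (i : ℕ) {x : ExteriorAlgebra R V}
    (hx : x ∈ ⋀[R]^(i + 1) V) : contract d x ∈ ⋀[R]^i V := by
  have h := exteriorPower_induction (p := fun j x => contract d x ∈ ⋀[R]^(j - 1) V)
    (fun a => by rw [contract_algebraMap]; exact zero_mem _)
    (fun i v x hx ih => by
      rw [contract_ι_mul]
      refine Submodule.sub_mem _ (Submodule.smul_mem _ _ hx) ?_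
      rcases i with _ | i
      · obtain ⟨a, rfl⟩ := mem_exteriorPower_zero_iff.mp hx
        rw [contract_algebraMap, mul_zero]
        exact zero_mem _
      · exact ι_mul_mem v ih)
    (fun i x y hx hy => by rw [map_add]; exact Submodule.add_mem _ hx hy) (i + 1) hx
  exact h

theorem contract_map (g : V →ₗ[R] V') (d : Module.Dual R V') (x : ExteriorAlgebra R V) :
    contract d (ExteriorAlgebra.map g x) =
      ExteriorAlgebra.map g (contract (d ∘ₗ g) x) := by
  induction x using exteriorAlgebra_induction with
  | algebraMap a => simp only [AlgHom.commutes, contract_algebraMap, map_zero]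
  | ι_mul v x ih =>
    rw [map_mul, ExteriorAlgebra.map_apply_ι, contract_ι_mul, contract_ι_mul, map_sub, map_smul,
      map_mul, ExteriorAlgebra.map_apply_ι, ih]
    rfl
  | add x y hx hy => simp only [map_add, hx, hy]

theorem map_mem_exteriorPower (g : V →ₗ[R] V') {i : ℕ} {x : ExteriorAlgebra R V}
    (hx : x ∈ ⋀[R]^i V) : ExteriorAlgebra.map g x ∈ ⋀[R]^i V' := by
  refine exteriorPower_induction (p := fun j x => ExteriorAlgebra.map g x ∈ ⋀[R]^j V')
    (fun a => ?_) (fun i v x _ ih => ?_) (fun i x y hx hy => ?_) i hx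
  · rw [AlgHom.commutes]
    exact mem_exteriorPower_zero_iff.mpr ⟨a, rfl⟩
  · rw [map_mul, ExteriorAlgebra.map_apply_ι]
    exact ι_mul_mem _ ih
  · rw [map_add]
    exact Submodule.add_mem _ hx hy

/-- The splitting Λ(W ⊕ Re) = ΛW ⊕ e ∧ ΛW, written with the projection π and the coordinate form ε
of e. -/
theorem map_map_add_ι_mul_contract {incl : V →ₗ[R] V'} {π : V' →ₗ[R] V} {e : V'}
    {ε : Module.Dual R V'} (h : ∀ v, incl (π v) + ε v • e = v) (x : ExteriorAlgebra R V') :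
    ExteriorAlgebra.map incl (ExteriorAlgebra.map π x) +
      ExteriorAlgebra.ι R e * contract ε x = x := by
  induction x using exteriorAlgebra_induction with
  | algebraMap a => simp only [AlgHom.commutes, contract_algebraMap, mul_zero, add_zero]
  | ι_mul v x ih =>
    have h1 : ExteriorAlgebra.map incl (ExteriorAlgebra.map π x) =
      x - ExteriorAlgebra.ι R e * contract ε x := eq_sub_of_add_eq ih
    have h2 : ExteriorAlgebra.ι R (incl (π v)) =
        ExteriorAlgebra.ι R v - ε v • ExteriorAlgebra.ι R e := by
      rw [← map_smul, ← map_sub]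
      exact congrArg _ (eq_sub_of_add_eq (h v))
    have h3 : ExteriorAlgebra.ι R v * ExteriorAlgebra.ι R e =
        -(ExteriorAlgebra.ι R e * ExteriorAlgebra.ι R v) := by
      rw [eq_neg_iff_add_eq_zero]
      exact ExteriorAlgebra.ι_add_mul_swap v e
    rw [map_mul, map_mul, ExteriorAlgebra.map_apply_ι, ExteriorAlgebra.map_apply_ι, h1, h2,
      contract_ι_mul, sub_mul, mul_sub, mul_sub, mul_sub, ← mul_assoc, h3, smul_mul_assoc,
      smul_mul_assoc, mul_smul_comm, ← mul_assoc (ExteriorAlgebra.ι R e),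
      ExteriorAlgebra.ι_sq_zero, neg_mul, zero_mul, smul_zero, mul_assoc]
    abel
  | add x y hx hy =>
    simp only [map_add, mul_add]
    rw [add_add_add_comm, hx, hy]

end Contraction

/-! ### Koszul cycles and the effect of adjoining zeros. -/

section Cycles

variable {R : Type u} [CommRing R] {V : Type u} [AddCommGroup V] [Module R V]
  {V' : Type u} [AddCommGroup V'] [Module R V']

/-- The cycles of degree `i` of the Koszul complex of the linear form `F`. -/
def cycles (F : Module.Dual R V) (i : ℕ) : Submodule R (ExteriorAlgebra R V) :=
  ⋀[R]^i V ⊓ LinearMap.ker (contract F)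

theorem mem_cycles {F : Module.Dual R V} {i : ℕ} {x : ExteriorAlgebra R V} :
    x ∈ cycles F i ↔ x ∈ ⋀[R]^i V ∧ contract F x = 0 := Iff.rfl

theorem contract_mem_cycles {F : Module.Dual R V} {i : ℕ} {x : ExteriorAlgebra R V}
    (d : Module.Dual R V) (hx : x ∈ cycles F (i + 1)) : contract d x ∈ cycles F i :=
  mem_cycles.mpr ⟨contract_mem d i hx.1, by
    rw [contract_comm, (mem_cycles.mp hx).2, map_zero, neg_zero]⟩

theorem ι_mul_mem_cycles {F : Module.Dual R V} {i : ℕ} {x : ExteriorAlgebra R V} {v : V}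
    (hv : F v = 0) (hx : x ∈ cycles F i) : ExteriorAlgebra.ι R v * x ∈ cycles F (i + 1) :=
  mem_cycles.mpr ⟨ι_mul_mem v hx.1, by
    rw [contract_ι_mul, hv, (mem_cycles.mp hx).2, zero_smul, mul_zero,
      sub_zero]⟩

theorem cycles_zero (F : Module.Dual R V) : cycles F 0 = ⋀[R]^0 V := by
  refine inf_eq_left.mpr fun x hx => ?_
  obtain ⟨a, rfl⟩ := mem_exteriorPower_zero_iff.mp hx
  exact contract_algebraMap F a

theorem projDimLT_cycles_zero [Module.Free R V] (F : Module.Dual R V) :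
    ProjDimLT R (cycles F 0) 1 := by
  have : Module.Free R (⋀[R]^0 V) := inferInstance
  rw [cycles_zero]
  exact projDimLT_one_of_projective

theorem map_mem_cycles {g : V →ₗ[R] V'} {F : Module.Dual R V} {F' : Module.Dual R V'}
    (hg : F' ∘ₗ g = F) {i : ℕ} {x : ExteriorAlgebra R V} (hx : x ∈ cycles F i) :
    ExteriorAlgebra.map g x ∈ cycles F' i :=
  mem_cycles.mpr ⟨map_mem_exteriorPower g hx.1, by
    rw [contract_map, hg, (mem_cycles.mp hx).2, map_zero]⟩

theorem map_comp_apply_of_comp_eq_id {g : V →ₗ[R] V'} {h : V' →ₗ[R] V} (hh : h ∘ₗ g = .id)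
    (x : ExteriorAlgebra R V) : ExteriorAlgebra.map h (ExteriorAlgebra.map g x) = x := by
  have := ExteriorAlgebra.map_comp_map g h
  rw [hh, ExteriorAlgebra.map_id] at this
  exact DFunLike.congr_fun this x

/-- Isomorphic linear forms have isomorphic Koszul cycles. -/
def cyclesEquiv (e : V ≃ₗ[R] V') {F : Module.Dual R V} {F' : Module.Dual R V'}
    (h : F' ∘ₗ e.toLinearMap = F) (i : ℕ) : cycles F i ≃ₗ[R] cycles F' i :=
  LinearEquiv.ofLinearMap
    ((ExteriorAlgebra.map e.toLinearMap).toLinearMap.restrict fun _ hx => map_mem_cycles h hx)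
    ((ExteriorAlgebra.map e.symm.toLinearMap).toLinearMap.restrict fun _ hx =>
      map_mem_cycles (F := F') (F' := F) (by rw [← h]; ext; simp) hx)
    (LinearMap.ext fun x => Subtype.ext (map_comp_apply_of_comp_eq_id (by simp) x.1))
    (LinearMap.ext fun x => Subtype.ext (map_comp_apply_of_comp_eq_id (by simp) x.1))

/-- Adding a zero to the sequence: the cycles of the new Koszul complex are an extension of the old
cycles, in consecutive degrees. -/
theorem projDimLT_cycles_of_splitting [Module.Free R V'] {F : Module.Dual R V}
    {F' : Module.Dual R V'} {incl : V →ₗ[R] V'} {π : V' →ₗ[R] V} {e : V'} {ε : Module.Dual R V'}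
    (hF : F' ∘ₗ incl = F) (he : F' e = 0) (hπ : π ∘ₗ incl = .id) (hε : ε ∘ₗ incl = 0)
    (hεe : ε e = 1) (hsplit : ∀ v, incl (π v) + ε v • e = v) {n : ℕ}
    (h : ∀ i, ProjDimLT R (cycles F i) (n - i)) (i : ℕ) :
    ProjDimLT R (cycles F' i) (n + 1 - i) := by
  rcases i with _ | i
  · exact (projDimLT_cycles_zero F').mono (by omega)
  have hFπ : F ∘ₗ π = F' := by
    ext v
    rw [← hF]
    have := congrArg F' (hsplit v)
    rw [map_add, map_smul, he, smul_zero, add_zero] at this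
    exact this
  let f : cycles F (i + 1) →ₗ[R] cycles F' (i + 1) :=
    (ExteriorAlgebra.map incl).toLinearMap.restrict fun _ hx => map_mem_cycles hF hx
  let g : cycles F' (i + 1) →ₗ[R] cycles F i :=
    ((ExteriorAlgebra.map π).toLinearMap ∘ₗ contract ε).restrict fun _ hx =>
      map_mem_cycles hFπ (contract_mem_cycles ε hx)
  have hf : ∀ x, (f x : ExteriorAlgebra R V') = ExteriorAlgebra.map incl x.1 := fun _ => rfl
  have hg : ∀ x, (g x : ExteriorAlgebra R V) = ExteriorAlgebra.map π (contract ε x.1) :=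
    fun _ => rfl
  have hincl : ∀ x, contract ε (ExteriorAlgebra.map incl x) = 0 := fun x => by
    rw [contract_map, hε, contract_zero, map_zero]
  refine ProjDimLT.middle (f := f) (g := g) ?_ ?_ ?_ ((h (i + 1)).mono (by omega))
    ((h i).mono (by omega))
  · intro x y hxy
    have h1 := congrArg (fun z : cycles F' (i + 1) => ExteriorAlgebra.map π z.1) hxy
    simp only [hf, map_comp_apply_of_comp_eq_id hπ] at h1
    exact Subtype.ext h1
  · intro y
    -- Since F' vanishes at e, the product e ∧ y is again a cycle.
    refine ⟨⟨ExteriorAlgebra.ι R e * ExteriorAlgebra.map incl y.1,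
      ι_mul_mem_cycles he (map_mem_cycles hF y.2)⟩, Subtype.ext ?_⟩
    rw [hg]
    simp only
    rw [contract_ι_mul, hεe, one_smul, hincl, mul_zero, sub_zero,
      map_comp_apply_of_comp_eq_id hπ]
  · intro x
    constructor
    · intro hx
      have h1 : ExteriorAlgebra.map π (contract ε x.1) = 0 := by rw [← hg, hx]; rfl
      have h2 := map_map_add_ι_mul_contract hsplit (contract ε x.1)
      rw [h1, map_zero, contract_contract, mul_zero, add_zero] at h2
      have h3 := map_map_add_ι_mul_contract hsplit x.1
      rw [← h2, mul_zero, add_zero] at h3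
      exact ⟨⟨ExteriorAlgebra.map π x.1, map_mem_cycles hFπ x.2⟩, Subtype.ext h3⟩
    · rintro ⟨y, rfl⟩
      refine Subtype.ext ?_
      rw [hg, hf, hincl, map_zero]
      rfl

theorem projDimLT_cycles_comp_fst [Module.Free R V] {F : Module.Dual R V} {n : ℕ}
    (h : ∀ i, ProjDimLT R (cycles F i) (n - i)) (s : ℕ) (i : ℕ) :
    ProjDimLT R (cycles (F ∘ₗ LinearMap.fst R V (Fin s → R)) i) (n + s - i) := by
  induction s generalizing i with
  | zero =>
    refine (h i).of_linearEquiv (cyclesEquiv (LinearEquiv.prodUnique.symm) ?_ i)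
    ext; rfl
  | succ s ih =>
    refine projDimLT_cycles_of_splitting (F := F ∘ₗ LinearMap.fst R V (Fin s → R))
      (incl := LinearMap.prodMap .id
        ((Fin.consLinearEquiv R (fun _ : Fin (s + 1) => R)).toLinearMap ∘ₗ LinearMap.inr R R _))
      (π := LinearMap.prodMap .id (LinearMap.funLeft R R Fin.succ))
      (e := (0, Pi.single 0 1)) (ε := LinearMap.proj 0 ∘ₗ LinearMap.snd R V (Fin (s + 1) → R))
      ?_ ?_ ?_ ?_ ?_ ?_ ih i
    · ext <;> simp
    · simp
    · refine LinearMap.ext fun x => Prod.ext rfl (funext fun j => ?_)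
      simp [LinearMap.funLeft]
    · refine LinearMap.ext fun x => ?_
      simp
    · simp
    · rintro ⟨x, y⟩
      refine Prod.ext (by simp) (funext fun j => ?_)
      cases j using Fin.cases <;> simp [LinearMap.funLeft]

end Cycles

/-! ### Projective dimension of Koszul cycles from Koszul homology. -/

section Koszul

variable {R : Type u} [CommRing R]

theorem exteriorPower_eq_bot_of_lt {n i : ℕ} (h : n < i) : ⋀[R]^i (Fin n → R) = ⊥ := by
  rw [← Submodule.subsingleton_iff_eq_bot]
  let b := (Pi.basisFun R (Fin n)).exteriorPower i
  have : IsEmpty (Set.powersetCard (Fin n) i) := by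
    refine ⟨fun t => ?_⟩
    have h1 := Finset.card_le_univ t.1
    have h2 : t.1.card = i := t.2
    rw [Fintype.card_fin] at h1
    omega
  exact b.repr.toEquiv.subsingleton

instance {V : Type*} [AddCommGroup V] [Module R V] [Module.Free R V] [Module.Finite R V] :
    Module.Finite R (ExteriorAlgebra R V) :=
  Module.Finite.of_basis ((Module.Free.chooseBasis R V).reindex (Fintype.equivFin _)).ExteriorAlgebra

/-- For a cycle x of degree at least n and F(v) ≠ 0, the product v ∧ x vanishes by degree;
contracting it with F gives F(v)x = 0, and the exterior algebra is torsion-free. -/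
theorem cycles_eq_bot_of_le [IsDomain R] {n : ℕ} {F : Module.Dual R (Fin n → R)} (hF : F ≠ 0)
    {i : ℕ} (hi : n ≤ i) : cycles F i = ⊥ := by
  have : Module.Free R (ExteriorAlgebra R (Fin n → R)) :=
    Module.Free.of_basis (Pi.basisFun R (Fin n)).ExteriorAlgebra
  rw [eq_bot_iff]
  intro x hx
  obtain ⟨v, hv⟩ : ∃ v, F v ≠ 0 := by
    by_contra! hcon
    exact hF (LinearMap.ext hcon)
  have h1 : ExteriorAlgebra.ι R v * x = 0 := by
    have := ι_mul_mem v hx.1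
    rwa [exteriorPower_eq_bot_of_lt (by omega), Submodule.mem_bot] at this
  have h2 := contract_ι_mul F v x
  rw [h1, map_zero, LinearMap.mem_ker.mp hx.2, mul_zero, sub_zero] at h2
  exact (smul_eq_zero.mp h2.symm).resolve_left hv

/-- Induction along 0 → B_i → Z_i → H_i → 0 and 0 → Z_{i+1} → Λ^{i+1} → B_i → 0. The degrees i ≥ n,
where the bound demands vanishing, need z ≠ 0. -/
theorem projDimLT_koszulCycles [IsDomain R] [IsNoetherianRing R] {n : ℕ} {z : Fin n → R}
    (hz : z ≠ 0) (h : ∀ i ≤ n, ProjDimLT R (KoszulHomology z i) (n - i + 1)) (i : ℕ) :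
    ProjDimLT R (koszulCycles z i) (n - i) := by
  have hF : Fintype.linearCombination R z ≠ 0 := by
    intro h0
    refine hz (funext fun j => ?_)
    have := LinearMap.congr_fun h0 (Pi.single j 1)
    simpa [Fintype.linearCombination_apply, Pi.single_apply] using this
  by_cases hi : n ≤ i
  · have h1 : koszulCycles z i = ⊥ := cycles_eq_bot_of_le hF hi
    rw [h1]
    exact projDimLT_of_subsingleton _
  push Not at hi
  induction i with
  | zero => exact (projDimLT_cycles_zero (Fintype.linearCombination R z)).mono (by omega)
  | succ i ih =>
    have h1 := ih (by omega)
    have h2 : ProjDimLT R (koszulBoundaries z i) (n - i) :=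
      (ProjDimLT.left (Submodule.injective_subtype _) (Submodule.mkQ_surjective _)
        (LinearMap.exact_subtype_mkQ ((koszulBoundaries z i).submoduleOf (koszulCycles z i)))
        h1 (h i (by omega))).of_linearEquiv
        (Submodule.submoduleOfEquivOfLe (koszulBoundaries_le_koszulCycles z i))
    have hfree : Module.Free R (⋀[R]^(i + 1) (Fin n → R)) := inferInstance
    refine ProjDimLT.left (N := ⋀[R]^(i + 1) (Fin n → R)) (P := koszulBoundaries z i)
      (f := Submodule.inclusion inf_le_left)
      (g := (koszulDifferential z).restrict fun x hx => Submodule.mem_map_of_mem hx)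
      (Submodule.inclusion_injective _) ?_ ?_ (projDimLT_one_of_projective.mono (by omega))
      (h2.mono (by omega))
    · rintro ⟨_, x, hx, rfl⟩
      exact ⟨⟨x, hx⟩, rfl⟩
    · intro x
      constructor
      · intro hx
        exact ⟨⟨x.1, x.2, congrArg Subtype.val hx⟩, rfl⟩
      · rintro ⟨y, rfl⟩
        exact Subtype.ext y.2.2

end Koszul

/-! ### The inverse polynomial complex and its homotopies. -/

section InversePolynomialComplex

variable {R : Type u} [CommRing R] {V : Type u} [AddCommGroup V] [Module R V] {r : ℕ}

/-- Successive contraction with the linear forms of a list. -/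
def contractList : List (Module.Dual R V) → ExteriorAlgebra R V →ₗ[R] ExteriorAlgebra R V
  | [] => .id
  | d :: l => contractList l ∘ₗ contract d

theorem contractList_nil (x : ExteriorAlgebra R V) :
    contractList ([] : List (Module.Dual R V)) x = x := rfl

theorem contractList_cons (d : Module.Dual R V) (l : List (Module.Dual R V))
    (x : ExteriorAlgebra R V) : contractList (d :: l) x = contractList l (contract d x) := rfl

theorem contract_contractList_eq_zero {d : Module.Dual R V} {l : List (Module.Dual R V)}
    {x : ExteriorAlgebra R V} (hx : contract d x = 0) : contract d (contractList l x) = 0 := by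
  induction l generalizing x with
  | nil => exact hx
  | cons d' l ih => exact ih (by rw [contract_comm, hx, map_zero, neg_zero])

theorem contractList_contract (l : List (Module.Dual R V)) (d : Module.Dual R V)
    (x : ExteriorAlgebra R V) :
    contractList l (contract d x) = (-1 : R) ^ l.length • contract d (contractList l x) := by
  induction l generalizing x with
  | nil => simp [contractList_nil]
  | cons d' l ih =>
    rw [contractList_cons, contractList_cons, contract_comm, map_neg, ih, List.length_cons, pow_succ,
      mul_neg_one, neg_smul]

theorem contract_contractList_of_mem {d : Module.Dual R V} {l : List (Module.Dual R V)}
    (hd : d ∈ l) (x : ExteriorAlgebra R V) : contract d (contractList l x) = 0 := by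
  induction l generalizing x with
  | nil => simp at hd
  | cons d' l ih =>
    rw [contractList_cons]
    rcases List.mem_cons.mp hd with rfl | hd
    · exact contract_contractList_eq_zero (contract_contract _ _)
    · exact ih hd _

theorem contractList_contract_eq_zero {d : Module.Dual R V} {l : List (Module.Dual R V)}
    (hd : d ∈ l) (x : ExteriorAlgebra R V) : contractList l (contract d x) = 0 := by
  rw [contractList_contract, contract_contractList_of_mem hd, smul_zero]

theorem contractList_append (l₁ l₂ : List (Module.Dual R V)) (x : ExteriorAlgebra R V) :
    contractList (l₁ ++ l₂) x = contractList l₂ (contractList l₁ x) := by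
  induction l₁ generalizing x with
  | nil => rfl
  | cons d l ih => exact ih _

theorem contractList_mem_exteriorPower {l : List (Module.Dual R V)} {i : ℕ}
    {x : ExteriorAlgebra R V} (hx : x ∈ ⋀[R]^(l.length + i) V) :
    contractList l x ∈ ⋀[R]^i V := by
  induction l generalizing x with
  | nil => simpa [contractList_nil] using hx
  | cons d l ih =>
    refine ih (contract_mem d _ ?_)
    rwa [List.length_cons, add_right_comm] at hx

/-- The differential `φ ↦ (β ↦ ∑ j, ℓⱼ ⌋ φ (β + eⱼ))` on functions from the monomials in `r`
variables to the exterior algebra. -/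
def diff (ℓ : Fin r → Module.Dual R V) :
    ((Fin r → ℕ) → ExteriorAlgebra R V) →ₗ[R] ((Fin r → ℕ) → ExteriorAlgebra R V) :=
  LinearMap.pi fun β => ∑ j, contract (ℓ j) ∘ₗ LinearMap.proj (β + Pi.single j 1)

theorem diff_apply (ℓ : Fin r → Module.Dual R V) (φ : (Fin r → ℕ) → ExteriorAlgebra R V)
    (β : Fin r → ℕ) : diff ℓ φ β = ∑ j, contract (ℓ j) (φ (β + Pi.single j 1)) := by
  simp [diff]

theorem diff_diff (ℓ : Fin r → Module.Dual R V) (φ : (Fin r → ℕ) → ExteriorAlgebra R V) :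
    diff ℓ (diff ℓ φ) = 0 := by
  funext β
  simp only [diff_apply, map_sum, Pi.zero_apply]
  rw [← Finset.sum_product']
  -- The terms indexed by (j,k) and (k,j) cancel because contractions anticommute.
  refine Finset.sum_involution (fun p _ => (p.2, p.1)) ?_ ?_ ?_ ?_
  · rintro ⟨j, k⟩ -
    simp only
    rw [contract_comm (ℓ j) (ℓ k), add_right_comm β (Pi.single j 1)]
    exact neg_add_cancel _
  · rintro ⟨j, k⟩ - hne heq
    obtain rfl : k = j := congrArg Prod.fst heq
    exact hne (contract_contract _ _)
  · intro p _
    exact Finset.mem_univ _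
  · intro p _
    rfl

/-- The functions supported in degree `m` with values in the Koszul cycles of degree `r + m`. -/
def chains (r : ℕ) (F : Module.Dual R V) (m : ℕ) :
    Submodule R ((Fin r → ℕ) → ExteriorAlgebra R V) :=
  Submodule.pi Set.univ fun α => if ∑ j, α j = m then cycles F (r + m) else ⊥

theorem mem_chains {F : Module.Dual R V} {m : ℕ} {φ : (Fin r → ℕ) → ExteriorAlgebra R V} :
    φ ∈ chains r F m ↔ (∀ α, ∑ j, α j = m → φ α ∈ cycles F (r + m)) ∧
      ∀ α, ∑ j, α j ≠ m → φ α = 0 := by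
  simp only [chains, Submodule.mem_pi, Set.mem_univ, forall_const]
  refine ⟨fun h => ⟨fun α hα => ?_, fun α hα => ?_⟩, fun h α => ?_⟩
  · simpa [hα] using h α
  · simpa [hα] using h α
  · split_ifs with hα
    · exact h.1 α hα
    · exact h.2 α hα

theorem sum_add_single (β : Fin r → ℕ) (j : Fin r) :
    ∑ k, (β + Pi.single j 1 : Fin r → ℕ) k = ∑ k, β k + 1 := by
  simp [Finset.sum_add_distrib]

theorem diff_mem_chains {F : Module.Dual R V} {m : ℕ} (ℓ : Fin r → Module.Dual R V)
    {φ : (Fin r → ℕ) → ExteriorAlgebra R V} (hφ : φ ∈ chains r F (m + 1)) :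
    diff ℓ φ ∈ chains r F m := by
  rw [mem_chains] at hφ ⊢
  refine ⟨fun α hα => ?_, fun α hα => ?_⟩
  · rw [diff_apply]
    refine Submodule.sum_mem _ fun j _ => contract_mem_cycles _ (hφ.1 _ ?_)
    rw [sum_add_single, hα]
  · rw [diff_apply]
    refine Finset.sum_eq_zero fun j _ => ?_
    rw [hφ.2 _ (by rw [sum_add_single]; omega), map_zero]

/-- The homotopy given by the variable `j` and exterior multiplication with the vector `w`. -/
def homotopy (j : Fin r) (w : V) (φ : (Fin r → ℕ) → ExteriorAlgebra R V) :
    (Fin r → ℕ) → ExteriorAlgebra R V :=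
  fun α => if α j = 0 then 0 else ExteriorAlgebra.ι R w * φ (α - Pi.single j 1)

/-- The defect of `homotopy`, supported in the monomials without the variable `j`. -/
def defect (ℓ : Fin r → Module.Dual R V) (j : Fin r) (w : V)
    (φ : (Fin r → ℕ) → ExteriorAlgebra R V) : (Fin r → ℕ) → ExteriorAlgebra R V :=
  fun α => if α j = 0 then ExteriorAlgebra.ι R w * contract (ℓ j) (φ α) else 0

theorem homotopy_mem_chains {F : Module.Dual R V} {m : ℕ} {j : Fin r} {w : V} (hw : F w = 0)
    {φ : (Fin r → ℕ) → ExteriorAlgebra R V} (hφ : φ ∈ chains r F m) :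
    homotopy j w φ ∈ chains r F (m + 1) := by
  have hsum : ∀ α : Fin r → ℕ, α j ≠ 0 →
      ∑ k, α k = ∑ k, (α - Pi.single j 1 : Fin r → ℕ) k + 1 := fun α hα => by
    rw [← sum_add_single, tsub_add_cancel_of_le]
    intro k
    rcases eq_or_ne k j with rfl | hk
    · simpa [Nat.one_le_iff_ne_zero] using hα
    · simp [hk]
  rw [mem_chains] at hφ ⊢
  refine ⟨fun α hα => ?_, fun α hα => ?_⟩
  · rw [homotopy]
    split_ifs with h
    · exact zero_mem _
    · exact ι_mul_mem_cycles hw (hφ.1 _ (by have := hsum α h; omega))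
  · rw [homotopy]
    split_ifs with h
    · rfl
    · rw [hφ.2 _ (by have := hsum α h; omega), mul_zero]

/-- Multiplying by the variable j and by w contracts x times a cycle, except where α_j = 0: there
the cycle relation at β - e_j is unavailable and the defect remains. -/
theorem diff_homotopy {ℓ : Fin r → Module.Dual R V} {j : Fin r} {w : V} {x : R}
    (hw : ∀ k, ℓ k w = if k = j then x else 0) {φ : (Fin r → ℕ) → ExteriorAlgebra R V}
    (hφ : diff ℓ φ = 0) : diff ℓ (homotopy j w φ) = x • φ - defect ℓ j w φ := by
  funext β
  have hj : homotopy j w φ (β + Pi.single j 1) = ExteriorAlgebra.ι R w * φ β := by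
    simp [homotopy]
  rw [diff_apply, ← Finset.add_sum_erase _ _ (Finset.mem_univ j), hj, contract_ι_mul, hw,
    if_pos rfl, Pi.sub_apply, Pi.smul_apply]
  rw [sub_add, sub_right_inj, defect]
  split_ifs with h
  · rw [Finset.sum_eq_zero, sub_zero]
    intro k hk
    have hkj := Finset.ne_of_mem_erase hk
    rw [homotopy, if_pos (by simp [h, hkj.symm]), map_zero]
  · have hle : (Pi.single j 1 : Fin r → ℕ) ≤ β := by
      intro k
      rcases eq_or_ne k j with rfl | hk
      · simpa [Nat.one_le_iff_ne_zero] using h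
      · simp [hk]
    have h1 := congrFun hφ (β - Pi.single j 1)
    rw [diff_apply, ← Finset.add_sum_erase _ _ (Finset.mem_univ j), tsub_add_cancel_of_le hle,
      Pi.zero_apply] at h1
    have h2 : ∑ k ∈ Finset.univ.erase j, contract (ℓ k) (homotopy j w φ (β + Pi.single k 1)) =
        -(ExteriorAlgebra.ι R w * ∑ k ∈ Finset.univ.erase j,
          contract (ℓ k) (φ (β - Pi.single j 1 + Pi.single k 1))) := by
      rw [Finset.mul_sum, ← Finset.sum_neg_distrib]
      refine Finset.sum_congr rfl fun k hk => ?_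
      have hkj := Finset.ne_of_mem_erase hk
      rw [homotopy, if_neg (by simp [h, hkj.symm]), contract_ι_mul, hw, if_neg hkj, zero_smul,
        zero_sub, tsub_add_eq_add_tsub hle]
    rw [h2, eq_neg_of_add_eq_zero_right h1, mul_neg, neg_neg, sub_self]

theorem defect_mem_chains {F : Module.Dual R V} {m : ℕ} {ℓ : Fin r → Module.Dual R V} {j : Fin r}
    {w : V} (hw : F w = 0) {φ : (Fin r → ℕ) → ExteriorAlgebra R V} (hφ : φ ∈ chains r F m) :
    defect ℓ j w φ ∈ chains r F m := by
  have hr : 0 < r := j.pos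
  rw [mem_chains] at hφ ⊢
  refine ⟨fun α hα => ?_, fun α hα => ?_⟩
  · rw [defect]
    split_ifs with h
    · have h1 := hφ.1 α hα
      obtain ⟨i, hi⟩ : ∃ i, r + m = i + 1 := ⟨r + m - 1, by omega⟩
      rw [hi] at h1 ⊢
      exact ι_mul_mem_cycles hw (contract_mem_cycles _ h1)
    · exact zero_mem _
  · rw [defect]
    split_ifs
    · rw [hφ.2 α hα, map_zero, mul_zero]
    · rfl

/-- The composition of the maps `y ↦ wⱼ ∧ (ℓⱼ ⌋ y)` over a list of indices. -/
def projList (ℓ : Fin r → Module.Dual R V) (w : Fin r → V) :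
    List (Fin r) → ExteriorAlgebra R V → ExteriorAlgebra R V
  | [], y => y
  | j :: l, y => ExteriorAlgebra.ι R (w j) * contract (ℓ j) (projList ℓ w l y)

theorem projList_zero (ℓ : Fin r → Module.Dual R V) (w : Fin r → V) (l : List (Fin r)) :
    projList ℓ w l 0 = 0 := by
  induction l with
  | nil => rfl
  | cons j l ih => rw [projList, ih, map_zero, mul_zero]

variable {ℓ : Fin r → Module.Dual R V} {w : Fin r → V} {x : R}

theorem contract_projList (hw : ∀ j k, ℓ k (w j) = if k = j then x else 0) {l : List (Fin r)}
    {j : Fin r} (hj : j ∉ l) (y : ExteriorAlgebra R V) :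
    contract (ℓ j) (projList ℓ w l y) = projList ℓ w l (contract (ℓ j) y) := by
  induction l with
  | nil => rfl
  | cons k l ih =>
    rw [List.mem_cons, not_or] at hj
    rw [projList, projList, contract_ι_mul, hw, if_neg hj.1, zero_smul, zero_sub, contract_comm,
      mul_neg, neg_neg, ih hj.2]

theorem projList_eq_zero (hw : ∀ j k, ℓ k (w j) = if k = j then x else 0) {l : List (Fin r)}
    (hl : l.Nodup) {y : ExteriorAlgebra R V} (hy : contractList (l.map ℓ) y = 0) :
    projList ℓ w l y = 0 := by
  induction l generalizing y with
  | nil => exact hy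
  | cons j l ih =>
    rw [List.nodup_cons] at hl
    rw [projList, contract_projList hw hl.1, ih hl.2 hy, mul_zero]

/-- Each index j costs one factor x and replaces the cycle by its defect, confining the support to
monomials free of that variable. -/
theorem exists_smul_sub_mem_map_diff (hw : ∀ j k, ℓ k (w j) = if k = j then x else 0)
    {F : Module.Dual R V} (hF : ∀ j, F (w j) = 0) {m : ℕ}
    {φ : (Fin r → ℕ) → ExteriorAlgebra R V} (hφ : φ ∈ chains r F m) (hdφ : diff ℓ φ = 0)
    (l : List (Fin r)) :
    ∃ ψ ∈ chains r F m, diff ℓ ψ = 0 ∧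
      x ^ l.length • φ - ψ ∈ (chains r F (m + 1)).map (diff ℓ) ∧
      ∀ α, ψ α = 0 ∨ ((∀ j ∈ l, α j = 0) ∧ ψ α = projList ℓ w l (φ α)) := by
  induction l with
  | nil => exact ⟨φ, hφ, hdφ, by simp, fun α => Or.inr ⟨by simp, rfl⟩⟩
  | cons j l ih =>
    obtain ⟨ψ, hψ, hdψ, hmem, hψα⟩ := ih
    have h1 := diff_homotopy (hw j) hdψ
    have h2 := homotopy_mem_chains (hF j) hψ (j := j)
    refine ⟨defect ℓ j (w j) ψ, defect_mem_chains (hF j) hψ, ?_, ?_, fun α => ?_⟩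
    · have h3 := congrArg (diff ℓ) h1
      rw [diff_diff, map_sub, map_smul, hdψ, smul_zero, zero_sub] at h3
      exact neg_eq_zero.mp h3.symm
    · have h3 : x ^ (j :: l).length • φ - defect ℓ j (w j) ψ =
          x • (x ^ l.length • φ - ψ) + diff ℓ (homotopy j (w j) ψ) := by
        rw [h1, smul_sub, List.length_cons, pow_succ', mul_smul]
        abel
      rw [h3]
      exact Submodule.add_mem _ (Submodule.smul_mem _ _ hmem) (Submodule.mem_map_of_mem h2)
    · rw [defect]
      split_ifs with h
      · rcases hψα α with h0 | ⟨h3, h4⟩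
        · exact Or.inl (by rw [h0, map_zero, mul_zero])
        · refine Or.inr ⟨?_, by rw [projList, h4]⟩
          intro k hk
          rcases List.mem_cons.mp hk with rfl | hk
          · exact h
          · exact h3 k hk
      · exact Or.inl rfl

/-- The homology of the complex of `chains`, augmented by `contractList`, is killed by `x ^ r`. -/
theorem pow_smul_mem_map_diff (hw : ∀ j k, ℓ k (w j) = if k = j then x else 0)
    {F : Module.Dual R V} (hF : ∀ j, F (w j) = 0) {m : ℕ}
    {φ : (Fin r → ℕ) → ExteriorAlgebra R V} (hφ : φ ∈ chains r F m) (hdφ : diff ℓ φ = 0)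
    (h0 : m = 0 → contractList ((List.finRange r).map ℓ) (φ 0) = 0) :
    x ^ r • φ ∈ (chains r F (m + 1)).map (diff ℓ) := by
  obtain ⟨ψ, -, -, hmem, hψ⟩ := exists_smul_sub_mem_map_diff hw hF hφ hdφ (List.finRange r)
  have hψ0 : ψ = 0 := by
    funext α
    rcases hψ α with h | ⟨h1, h2⟩
    · exact h
    -- Once all variables are used, only the monomial 1 survives. For m ≠ 0 it is outside the
    -- support; for m = 0 the augmentation hypothesis kills its value.
    · obtain rfl : α = 0 := funext fun j => h1 j (List.mem_finRange j)
      rw [h2, Pi.zero_apply]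
      by_cases hm : m = 0
      · exact projList_eq_zero hw (List.nodup_finRange r) (h0 hm)
      · rw [(mem_chains.mp hφ).2 0 (by simpa using Ne.symm hm), projList_zero]
  rwa [hψ0, sub_zero, List.length_finRange] at hmem

theorem diff_eq_zero_of_mem_chains_zero {F : Module.Dual R V}
    {φ : (Fin r → ℕ) → ExteriorAlgebra R V} (hφ : φ ∈ chains r F 0) : diff ℓ φ = 0 := by
  funext β
  rw [diff_apply]
  refine Finset.sum_eq_zero fun j _ => ?_
  rw [(mem_chains.mp hφ).2 _ (by rw [sum_add_single]; omega), map_zero]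

end InversePolynomialComplex

/-! ### Exactness of the complex and the bound for K'. -/

section Acyclicity

variable {R : Type u} [CommRing R]

theorem ProjDimLT.map_of_ker {A A' : Type u} [AddCommGroup A] [Module R A] [AddCommGroup A']
    [Module R A'] {X B : Submodule R A} {T : A →ₗ[R] A'} (hBX : B ≤ X)
    (h : ∀ φ ∈ X, T φ = 0 ↔ φ ∈ B) {n : ℕ} (hB : ProjDimLT R B n) (hX : ProjDimLT R X (n + 1)) :
    ProjDimLT R (X.map T) (n + 1) := by
  refine ProjDimLT.right (f := Submodule.inclusion hBX)
    (g := T.restrict fun _ hx => Submodule.mem_map_of_mem hx) (Submodule.inclusion_injective _)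
    ?_ ?_ hB hX
  · rintro ⟨_, x, hx, rfl⟩
    exact ⟨⟨x, hx⟩, rfl⟩
  · intro x
    constructor
    · intro hx
      exact ⟨⟨x.1, (h x.1 x.2).mp (congrArg Subtype.val hx)⟩, rfl⟩
    · rintro ⟨y, rfl⟩
      exact Subtype.ext ((h y.1 (hBX y.2)).mpr y.2)

/-- The quotient X/B has projective dimension at most n, so it has no nonzero element killed by
powers of all elements of an ideal of height at least n + 1. -/
theorem mem_of_pow_smul_mem [IsRegularLocalRing R] {A : Type u} [AddCommGroup A] [Module R A]
    {X B : Submodule R A} [Module.Finite R X] (hBX : B ≤ X) {n : ℕ} (hB : ProjDimLT R B n)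
    (hX : ProjDimLT R X (n + 1)) {b : Ideal R} (hb : ((n + 1 : ℕ) : ℕ∞) ≤ b.height) {φ : A}
    (hφ : φ ∈ X) (h : ∀ x ∈ b, ∃ k : ℕ, x ^ k • φ ∈ B) : φ ∈ B := by
  have h1 : ProjDimLT R (X ⧸ B.submoduleOf X) (n + 1) :=
    ProjDimLT.quotient _ (hB.of_linearEquiv (Submodule.submoduleOfEquivOfLe hBX).symm) hX
  have h2 := eq_zero_of_projDimLT_of_pow h1 hb (y := Submodule.Quotient.mk ⟨φ, hφ⟩) fun x hx => by
    obtain ⟨k, hk⟩ := h x hx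
    refine ⟨k, ?_⟩
    rw [← Submodule.Quotient.mk_smul, Submodule.Quotient.mk_eq_zero]
    exact hk
  rw [Submodule.Quotient.mk_eq_zero] at h2
  exact h2

variable {V : Type u} [AddCommGroup V] [Module R V] {r : ℕ}

instance (m : ℕ) : Finite {α : Fin r → ℕ // ∑ j, α j = m} := by
  refine Finite.of_injective (β := Fin r → Fin (m + 1))
    (fun α j => ⟨α.1 j, Nat.lt_succ_of_le ((Finset.single_le_sum (fun _ _ => Nat.zero_le _)
      (Finset.mem_univ j)).trans α.2.le)⟩) fun α β h => Subtype.ext (funext fun j => ?_)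
  simpa using congrFun h j

/-- The chains of degree `m` are a finite power of the Koszul cycles of degree `r + m`. -/
def chainsEquiv (r : ℕ) (F : Module.Dual R V) (m : ℕ) :
    chains r F m ≃ₗ[R] ({α : Fin r → ℕ // ∑ j, α j = m} → cycles F (r + m)) where
  toFun φ α := ⟨φ.1 α.1, (mem_chains.mp φ.2).1 α.1 α.2⟩
  map_add' _ _ := rfl
  map_smul' _ _ := rfl
  invFun ψ := ⟨fun α => if h : ∑ j, α j = m then (ψ ⟨α, h⟩ : ExteriorAlgebra R V) else 0, by
    refine mem_chains.mpr ⟨fun α hα => ?_, fun α hα => ?_⟩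
    · rw [dif_pos hα]
      exact (ψ ⟨α, hα⟩).2
    · rw [dif_neg hα]⟩
  left_inv φ := by
    refine Subtype.ext (funext fun α => ?_)
    by_cases h : ∑ j, α j = m
    · simp [h]
    · simp [h, (mem_chains.mp φ.2).2 α h]
  right_inv ψ := by
    refine funext fun α => Subtype.ext ?_
    simp [α.2]

theorem finite_chains [IsNoetherianRing R] [Module.Free R V] [Module.Finite R V]
    (F : Module.Dual R V) (m : ℕ) : Module.Finite R (chains r F m) :=
  Module.Finite.equiv (chainsEquiv r F m).symm

variable {F : Module.Dual R V} {s : ℕ}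

theorem projDimLT_chains (hpd : ∀ i, ProjDimLT R (cycles F i) (r + s - i)) (m : ℕ) :
    ProjDimLT R (chains r F m) (s - m) :=
  (ProjDimLT.pi (hpd (r + m)) _ (chainsEquiv r F m)).mono (by omega)

theorem map_diff_le (ℓ : Fin r → Module.Dual R V) (m : ℕ) :
    (chains r F (m + 1)).map (diff ℓ) ≤ chains r F m := by
  rintro _ ⟨φ, hφ, rfl⟩
  exact diff_mem_chains ℓ hφ

theorem projDimLT_map_of_subsingleton {A A' : Type u} [AddCommGroup A] [Module R A]
    [AddCommGroup A'] [Module R A'] {X : Submodule R A} (T : A →ₗ[R] A') (hX : ProjDimLT R X 0)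
    (n : ℕ) : ProjDimLT R (X.map T) n := by
  have := projDimLT_zero_iff.mp hX
  rw [Submodule.subsingleton_iff_eq_bot] at this
  rw [this, Submodule.map_bot]
  exact projDimLT_of_subsingleton n

variable {ℓ : Fin r → Module.Dual R V}

/-- The coefficients of the Koszul cycles of degree `r` along the forms `ℓ`. -/
def cycleIdeal (F : Module.Dual R V) (ℓ : Fin r → Module.Dual R V) : Ideal R :=
  (cycles F r).map ((ExteriorAlgebra.algebraMapInv (R := R) (M := V)).toLinearMap ∘ₗ
    contractList ((List.finRange r).map ℓ))

theorem algebraMap_algebraMapInv {x : ExteriorAlgebra R V} (hx : x ∈ ⋀[R]^0 V) :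
    algebraMap R _ (ExteriorAlgebra.algebraMapInv x) = x := by
  obtain ⟨a, rfl⟩ := mem_exteriorPower_zero_iff.mp hx
  rw [ExteriorAlgebra.algebraMap_leftInverse V a]

theorem mem_cycleIdeal {a : R} : a ∈ cycleIdeal F ℓ ↔
    ∃ y ∈ cycles F r, contractList ((List.finRange r).map ℓ) y = algebraMap R _ a := by
  constructor
  · rintro ⟨y, hy, rfl⟩
    refine ⟨y, hy, ?_⟩
    rw [LinearMap.comp_apply, AlgHom.toLinearMap_apply, algebraMap_algebraMapInv]
    exact contractList_mem_exteriorPower (by simpa using hy.1)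
  · rintro ⟨y, hy, h⟩
    refine ⟨y, hy, ?_⟩
    rw [LinearMap.comp_apply, AlgHom.toLinearMap_apply, h,
      ExteriorAlgebra.algebraMap_leftInverse V a]

variable [IsRegularLocalRing R] [Module.Free R V] [Module.Finite R V] {b : Ideal R}

/-- Descending induction on m, run through t. Exactness at m presents the image of degree m as the
degree m chains modulo the image of degree m + 1. -/
theorem projDimLT_map_diff (hpd : ∀ i, ProjDimLT R (cycles F i) (r + s - i))
    (hb : (s : ℕ∞) ≤ b.height)
    (hw : ∀ x ∈ b, ∃ w : Fin r → V, (∀ j k, ℓ k (w j) = if k = j then x else 0) ∧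
      ∀ j, F (w j) = 0) (t m : ℕ) (hm : m ≠ 0) (ht : s ≤ m + t) :
    ProjDimLT R ((chains r F m).map (diff ℓ)) (s - m) := by
  induction t generalizing m with
  | zero =>
    exact projDimLT_map_of_subsingleton _ ((projDimLT_chains hpd m).mono (by omega)) _
  | succ t ih =>
    by_cases hms : s ≤ m
    · exact projDimLT_map_of_subsingleton _ ((projDimLT_chains hpd m).mono (by omega)) _
    have := finite_chains (r := r) F m
    have h1 := ih (m + 1) (by omega) (by omega)
    have h2 : ProjDimLT R (chains r F m) (s - (m + 1) + 1) :=
      (projDimLT_chains hpd m).mono (by omega)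
    refine (ProjDimLT.map_of_ker (map_diff_le ℓ m) (fun φ hφ => ⟨fun hd => ?_, ?_⟩) h1 h2).mono
      (by omega)
    · refine mem_of_pow_smul_mem (map_diff_le ℓ m) h1 h2
        ((Nat.cast_le.mpr (by omega)).trans hb) hφ fun x hx => ?_
      obtain ⟨w, hw1, hw2⟩ := hw x hx
      exact ⟨r, pow_smul_mem_map_diff hw1 hw2 hφ hd fun h => absurd h hm⟩
    · rintro ⟨ψ, -, rfl⟩
      exact diff_diff ℓ ψ

theorem projDimLT_cycleIdeal (hpd : ∀ i, ProjDimLT R (cycles F i) (r + s - i))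
    (hb : (s : ℕ∞) ≤ b.height)
    (hw : ∀ x ∈ b, ∃ w : Fin r → V, (∀ j k, ℓ k (w j) = if k = j then x else 0) ∧
      ∀ j, F (w j) = 0) :
    ProjDimLT R (cycleIdeal F ℓ) s := by
  -- For s = 0 the cycles of degree r vanish, so K' = 0; the step below needs s - 1 + 1 = s.
  rcases Nat.eq_zero_or_pos s with rfl | hs
  · exact projDimLT_map_of_subsingleton _ ((hpd r).mono (by omega)) _
  have := finite_chains (r := r) F 0
  let T : ((Fin r → ℕ) → ExteriorAlgebra R V) →ₗ[R] R :=
    ((ExteriorAlgebra.algebraMapInv (R := R) (M := V)).toLinearMap ∘ₗ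
      contractList ((List.finRange r).map ℓ)) ∘ₗ LinearMap.proj 0
  have hT : cycleIdeal F ℓ = (chains r F 0).map T := by
    ext a
    constructor
    · rintro ⟨y, hy, rfl⟩
      refine ⟨Pi.single 0 y, mem_chains.mpr ⟨fun α hα => ?_, fun α hα => ?_⟩, ?_⟩
      · obtain rfl : α = 0 := funext fun j => by
          simpa using (Finset.sum_eq_zero_iff.mp hα) j (Finset.mem_univ j)
        simpa using hy
      · exact Pi.single_eq_of_ne (fun h => hα (by simp [h])) _
      · simp [T]
    · rintro ⟨φ, hφ, rfl⟩
      exact ⟨φ 0, (mem_chains.mp hφ).1 0 (by simp), rfl⟩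
  have h1 := projDimLT_map_diff hpd hb hw s 1 one_ne_zero (by omega)
  have h2 : ProjDimLT R (chains r F 0) (s - 1 + 1) := (projDimLT_chains hpd 0).mono (by omega)
  rw [hT]
  have hz : ∀ φ ∈ chains r F 0, contractList ((List.finRange r).map ℓ) (φ 0) ∈ ⋀[R]^0 V :=
    fun φ hφ => contractList_mem_exteriorPower (by
      simpa using ((mem_chains.mp hφ).1 0 (by simp)).1)
  refine (ProjDimLT.map_of_ker (map_diff_le ℓ 0) (fun φ hφ => ⟨fun hd => ?_, ?_⟩) h1 h2).mono
    (by omega)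
  · refine mem_of_pow_smul_mem (map_diff_le ℓ 0) h1 h2
      ((Nat.cast_le.mpr (by omega)).trans hb) hφ fun x hx => ?_
    obtain ⟨w, hw1, hw2⟩ := hw x hx
    refine ⟨r, pow_smul_mem_map_diff hw1 hw2 hφ (diff_eq_zero_of_mem_chains_zero hφ) fun _ => ?_⟩
    rw [← algebraMap_algebraMapInv (hz φ hφ)]
    exact (congrArg (algebraMap R (ExteriorAlgebra R V)) hd).trans (map_zero _)
  · rintro ⟨ψ, -, rfl⟩
    have : contractList ((List.finRange r).map ℓ) (diff ℓ ψ 0) = 0 := by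
      rw [diff_apply, map_sum]
      refine Finset.sum_eq_zero fun j _ => ?_
      exact contractList_contract_eq_zero (List.mem_map_of_mem (List.mem_finRange j)) _
    simp only [T, LinearMap.comp_apply, LinearMap.proj_apply, this, map_zero]

end Acyclicity

/-! ### Comparison of K' with J and J : I. -/

section CycleIdeal

variable {R : Type u} [CommRing R] {V : Type u} [AddCommGroup V] [Module R V] {r : ℕ}
  {F : Module.Dual R V} {ℓ : Fin r → Module.Dual R V}

/-- The exterior product of the vectors `w j`, for `j` in a list, and of `y`. -/
def mulList (w : Fin r → V) (y : ExteriorAlgebra R V) : List (Fin r) → ExteriorAlgebra R V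
  | [] => y
  | j :: l => ExteriorAlgebra.ι R (w j) * mulList w y l

theorem mulList_mem_exteriorPower (w : Fin r → V) {y : ExteriorAlgebra R V} {i : ℕ}
    (hy : y ∈ ⋀[R]^i V) (l : List (Fin r)) : mulList w y l ∈ ⋀[R]^(l.length + i) V := by
  induction l with
  | nil => simpa [mulList] using hy
  | cons j l ih =>
    rw [mulList, List.length_cons, add_right_comm]
    exact ι_mul_mem _ ih

theorem contract_mulList_eq_zero {w : Fin r → V} {y : ExteriorAlgebra R V} {d : Module.Dual R V}
    (hy : contract d y = 0) {l : List (Fin r)} (hl : ∀ j ∈ l, d (w j) = 0) :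
    contract d (mulList w y l) = 0 := by
  induction l with
  | nil => exact hy
  | cons j l ih =>
    rw [mulList, contract_ι_mul, hl j (by simp), ih fun k hk => hl k (by simp [hk]), zero_smul,
      mul_zero, sub_zero]

theorem contractList_mulList {w : Fin r → V} {x : R}
    (hw : ∀ j k, ℓ k (w j) = if k = j then x else 0) {y : ExteriorAlgebra R V}
    (hy : ∀ k, contract (ℓ k) y = 0) {l : List (Fin r)} (hl : l.Nodup) :
    contractList (l.map ℓ) (mulList w y l) = x ^ l.length • y := by
  induction l with
  | nil => simp [mulList, contractList_nil]
  | cons j l ih =>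
    rw [List.nodup_cons] at hl
    rw [List.map_cons, contractList_cons, mulList, contract_ι_mul, hw, if_pos rfl,
      contract_mulList_eq_zero (hy j), mul_zero, sub_zero, map_smul, ih hl.2, smul_smul,
      List.length_cons, pow_succ']
    intro k hk
    rw [hw, if_neg (by rintro rfl; exact hl.1 hk)]

/-- The product w_1 ∧ … ∧ w_r is a cycle whose full contraction is x^r. -/
theorem pow_mem_cycleIdeal {w : Fin r → V} {x : R}
    (hw : ∀ j k, ℓ k (w j) = if k = j then x else 0) (hF : ∀ j, F (w j) = 0) :
    x ^ r ∈ cycleIdeal F ℓ := by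
  have h1 : ∀ d : Module.Dual R V, contract d (1 : ExteriorAlgebra R V) = 0 := fun d => by
    rw [← map_one (algebraMap R (ExteriorAlgebra R V)), contract_algebraMap]
  refine mem_cycleIdeal.mpr ⟨mulList w 1 (List.finRange r), mem_cycles.mpr ⟨?_, ?_⟩, ?_⟩
  · simpa using mulList_mem_exteriorPower w
      (mem_exteriorPower_zero_iff.mpr ⟨1, map_one _⟩ : (1 : ExteriorAlgebra R V) ∈ ⋀[R]^0 V)
      (List.finRange r)
  · exact contract_mulList_eq_zero (h1 F) fun j _ => hF j
  · rw [contractList_mulList hw (fun k => h1 (ℓ k)) (List.nodup_finRange r), List.length_finRange,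
      Algebra.algebraMap_eq_smul_one]

/-- The boundary of e_1 ∧ … ∧ e_r ∧ u is a cycle of degree r, and its full contraction is F(u) up to
sign. -/
theorem apply_mem_cycleIdeal {e : Fin r → V} (he : ∀ j k, ℓ k (e j) = if k = j then 1 else 0)
    {u : V} (hu : ∀ k, ℓ k u = 0) : F u ∈ cycleIdeal F ℓ := by
  let y := mulList e (ExteriorAlgebra.ι R u) (List.finRange r)
  have hι : ∀ d : Module.Dual R V, contract d (ExteriorAlgebra.ι R u) = algebraMap R _ (d u) :=
    fun d => CliffordAlgebra.contractLeft_ι (Q := 0) d u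
  have hy : y ∈ ⋀[R]^(r + 1) V := by
    have h1 : ExteriorAlgebra.ι R u ∈ ⋀[R]^1 V := by
      rw [ExteriorAlgebra.exteriorPower, pow_one]
      exact LinearMap.mem_range_self _ u
    simpa using mulList_mem_exteriorPower e h1 (List.finRange r)
  have h2 : contractList ((List.finRange r).map ℓ) (contract F y) =
      algebraMap R _ ((-1) ^ r * F u) := by
    rw [contractList_contract, contractList_mulList he (fun k => by rw [hι, hu, map_zero])
      (List.nodup_finRange r), one_pow, one_smul, hι, List.length_map, List.length_finRange,
      Algebra.smul_def, map_mul]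
  have h3 : (-1) ^ r * F u ∈ cycleIdeal F ℓ :=
    mem_cycleIdeal.mpr ⟨contract F y, mem_cycles.mpr ⟨contract_mem F r hy, contract_contract F y⟩,
      h2⟩
  have h4 := Ideal.mul_mem_left _ ((-1) ^ r) h3
  rwa [← mul_assoc, ← mul_pow, neg_one_mul, neg_neg, one_pow, one_mul] at h4

/-- Contract the cycle with every ℓ_j except ℓ_k to get y' in degree 1. Contracting y' with ∑ z_j
ℓ_j leaves ± z_k a, while F kills y', so only terms with coefficients γ_i remain. -/
theorem mul_mem_of_mem_cycleIdeal {z : Fin r → R} {J : Ideal R}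
    {κ : Type*} [Fintype κ] {γ : κ → R} (hγ : ∀ i, γ i ∈ J) {δ : κ → Module.Dual R V}
    (h : ∑ j, z j • ℓ j = F + ∑ i, γ i • δ i) {a : R} (ha : a ∈ cycleIdeal F ℓ) (k : Fin r) :
    z k * a ∈ J := by
  obtain ⟨y, hy, hya⟩ := mem_cycleIdeal.mp ha
  obtain ⟨l₁, l₂, hl⟩ := List.append_of_mem (List.mem_finRange k)
  have hlen : l₁.length + (l₂.length + 1) = r := by
    rw [← List.length_cons, ← List.length_append, ← hl, List.length_finRange]
  let y' := contractList ((l₁ ++ l₂).map ℓ) y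
  have hy' : y' ∈ ⋀[R]^1 V := contractList_mem_exteriorPower (by
    rw [List.length_map, List.length_append, add_assoc, hlen]
    exact hy.1)
  have h1 : contractList ((List.finRange r).map ℓ) y =
      (-1 : R) ^ l₂.length • contract (ℓ k) y' := by
    rw [hl, List.map_append, List.map_cons, contractList_append, contractList_cons,
      contractList_contract, ← contractList_append, ← List.map_append, List.length_map]
  have h2 : ∀ j ≠ k, contract (ℓ j) y' = 0 := fun j hj => by
    refine contract_contractList_of_mem (List.mem_map_of_mem ?_) y
    have := List.mem_finRange j
    rw [hl] at this
    simp only [List.mem_append, List.mem_cons, hj, false_or] at this ⊢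
    exact this
  have h3 : z k • contract (ℓ k) y' = ∑ i, γ i • contract (δ i) y' := by
    have h4 := congrArg (fun d => contract d y') h
    simp only [contract_sum, contract_add, contract_smul] at h4
    rw [contract_contractList_eq_zero (mem_cycles.mp hy).2, zero_add,
      Finset.sum_eq_single k (fun j _ hj => by rw [h2 j hj, smul_zero])
        (fun h => absurd (Finset.mem_univ k) h)] at h4
    exact h4
  have h5 : z k * a = (-1) ^ l₂.length *
      ∑ i, γ i * ExteriorAlgebra.algebraMapInv (contract (δ i) y') := by
    apply (ExteriorAlgebra.algebraMap_leftInverse (R := R) V).injective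
    rw [map_mul, ← hya, h1, ← Algebra.smul_def, smul_comm, h3, map_mul, map_sum,
      ← Algebra.smul_def]
    congr 1
    refine Finset.sum_congr rfl fun i _ => ?_
    rw [map_mul, algebraMap_algebraMapInv (contract_mem _ 0 hy'), ← Algebra.smul_def]
  rw [h5]
  exact Ideal.mul_mem_left _ _ (Ideal.sum_mem _ fun i _ => Ideal.mul_mem_right _ _ (hγ i))

end CycleIdeal

/-! ### Identification of K' with the residual intersection. -/

section Residual

variable {R : Type u} [CommRing R]

theorem projDimLT_quotient_of_projDimLT {K : Ideal R} {s : ℕ} (h : ProjDimLT R K s) :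
    ProjDimLT R (R ⧸ K) (s + 1) :=
  ProjDimLT.quotient K h (projDimLT_one_of_projective.mono (by omega))

theorem le_of_mul_mem_of_height [IsRegularLocalRing R] {I K K' : Ideal R} {s : ℕ}
    (hK' : ProjDimLT R K' s) (hI : ∀ a ∈ K, ∀ i ∈ I, i * a ∈ K')
    (hpow : ∀ a ∈ K, ∃ k : ℕ, a ^ k ∈ K') (hht : (s : ℕ∞) < (I ⊔ K).height) : K ≤ K' := by
  intro a ha
  have h0 : ∀ i ∈ I, i • (Ideal.Quotient.mk K' a : R ⧸ K') = 0 := fun i hi => by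
    rw [Algebra.smul_def, Ideal.Quotient.algebraMap_eq, ← map_mul]
    exact Ideal.Quotient.eq_zero_iff_mem.mpr (hI a ha i hi)
  rw [← Ideal.Quotient.eq_zero_iff_mem]
  refine eq_zero_of_projDimLT_of_pow (projDimLT_quotient_of_projDimLT hK') (b := I ⊔ K) ?_ ?_
  · rw [Nat.cast_add, Nat.cast_one]
    exact Order.add_one_le_of_lt hht
  · intro x hx
    obtain ⟨i, hi, c, hc, rfl⟩ := Submodule.mem_sup.mp hx
    obtain ⟨k, hk⟩ := hpow c hc
    refine ⟨k, ?_⟩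
    -- As i kills the class of a, powers of i + c act on it as powers of c.
    have h1 : ∀ m : ℕ, (i + c) ^ m • (Ideal.Quotient.mk K' a : R ⧸ K') =
        c ^ m • Ideal.Quotient.mk K' a := by
      intro m
      induction m with
      | zero => simp
      | succ m ih =>
        rw [pow_succ', mul_smul, ih, add_smul, smul_comm, h0 i hi, smul_zero, zero_add, smul_smul,
          ← pow_succ']
    rw [h1, Algebra.smul_def, Ideal.Quotient.algebraMap_eq, ← map_mul]
    exact Ideal.Quotient.eq_zero_iff_mem.mpr (Ideal.mul_mem_right _ _ hk)

end Residual

end ResidualIntersection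

theorem corollary3p8 {R : Type*} [CommRing R] [IsRegularLocalRing R] (I : Ideal R)
    (hSD : ResidualIntersection.HasSlidingDepth I)
    (hμ : ∀ (p : Ideal R) [p.IsPrime], I ≤ p →
      (ResidualIntersection.localNumGenerators I p : WithBot ℕ∞) ≤
        ringKrullDim (Localization.AtPrime p) + 1)
    (s : ℕ) (K : Ideal R) (hK : ResidualIntersection.IsGeometricResidualIntersection s I K) :
    ResidualIntersection.IsPerfect K ∧ ResidualIntersection.grade K = (s : ℕ∞) := by
  open ResidualIntersection in
  have hdom := isDomain_of_isRegularLocalRing R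
  obtain ⟨r, z, rfl, hdepth⟩ := hSD
  obtain ⟨_, ⟨γ, rfl⟩, hlt, rfl, hht, hht'⟩ := hK
  set I := Ideal.span (Set.range z) with hI
  set J := Ideal.span (Set.range γ) with hJ
  have hzI : ∀ j, z j ∈ I := fun j => Ideal.subset_span ⟨j, rfl⟩
  have hγJ : ∀ i, γ i ∈ J := fun i => Ideal.subset_span ⟨i, rfl⟩
  have hz : z ≠ 0 := by
    rintro rfl
    exact not_lt_bot (hlt.trans_eq (by simp [hI]))
  have hcolon : ∀ a, a ∈ J.colon (I : Set R) ↔ ∀ j, z j * a ∈ J := by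
    intro a
    rw [Submodule.mem_colon]
    refine ⟨fun h j => by simpa [mul_comm] using h (z j) (hzI j), fun h y hy => ?_⟩
    rw [smul_eq_mul]
    refine Submodule.span_induction (p := fun y _ => a * y ∈ J) ?_ ?_ ?_ ?_ hy
    · rintro _ ⟨j, rfl⟩
      rw [mul_comm]
      exact h j
    · simp
    · intro y y' _ _ h1 h2
      rw [mul_add]
      exact Ideal.add_mem _ h1 h2
    · intro c y _ h1
      rw [smul_eq_mul, mul_left_comm]
      exact Ideal.mul_mem_left _ _ h1
  have hne : J.colon (I : Set R) ≠ ⊤ := by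
    intro h
    refine not_le_of_gt hlt (Ideal.span_le.mpr ?_)
    rintro _ ⟨j, rfl⟩
    have := (hcolon 1).mp (h ▸ Submodule.mem_top) j
    rwa [mul_one] at this
  choose c hc using fun i => Ideal.mem_span_range_iff_exists_fun.mp (hlt.le (hγJ i))
  let F : Module.Dual R ((Fin r → R) × (Fin s → R)) :=
    Fintype.linearCombination R z ∘ₗ LinearMap.fst R (Fin r → R) (Fin s → R)
  have hF : ∀ v, F v = ∑ j, v.1 j * z j := fun v => rfl
  let δ : Fin s → Module.Dual R ((Fin r → R) × (Fin s → R)) := fun i =>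
    LinearMap.proj i ∘ₗ LinearMap.snd R _ _
  let ℓ : Fin r → Module.Dual R ((Fin r → R) × (Fin s → R)) := fun j =>
    LinearMap.proj j ∘ₗ LinearMap.fst R _ _ + ∑ i, c i j • δ i
  have hℓ : ∀ j v, ℓ j v = v.1 j + ∑ i, c i j * v.2 i := fun j v => by simp [ℓ, δ]
  have hpd : ∀ i, ProjDimLT R (cycles F i) (r + s - i) :=
    projDimLT_cycles_comp_fst (projDimLT_koszulCycles hz
      fun i hi => projDimLT_of_le_depth hi (hdepth i)) s
  have hw : ∀ x ∈ J.colon (I : Set R), ∃ w : Fin r → (Fin r → R) × (Fin s → R),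
      (∀ j k, ℓ k (w j) = if k = j then x else 0) ∧ ∀ j, F (w j) = 0 := by
    intro x hx
    choose y hy using fun j => Ideal.mem_span_range_iff_exists_fun.mp ((hcolon x).mp hx j)
    -- With x z_j = ∑_i y_ji γ_i, the second component y_j is corrected in the first by ∑_i y_ji
    -- c_i: the c-terms cancel in ℓ_k, and F gives x z_j - ∑_i y_ji γ_i = 0.
    refine ⟨fun j => (Pi.single j x - ∑ i, y j i • c i, y j), fun j k => ?_, fun j => ?_⟩
    · rw [hℓ]
      simp [Pi.single_apply, mul_comm]
    · rw [hF]
      simp only [Pi.sub_apply, Finset.sum_apply, Pi.smul_apply, smul_eq_mul, sub_mul,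
        Finset.sum_sub_distrib, Finset.sum_mul]
      rw [Finset.sum_comm]
      simp only [mul_assoc, ← Finset.mul_sum, hc, hy]
      simp [Pi.single_apply, mul_comm]
  have hsum : ∑ j, z j • ℓ j = F + ∑ i, γ i • δ i := by
    refine LinearMap.ext fun v => ?_
    simp only [LinearMap.sum_apply, LinearMap.smul_apply, LinearMap.add_apply, hℓ, hF, smul_eq_mul,
      mul_add, Finset.sum_add_distrib, Finset.mul_sum]
    congr 1
    · exact Finset.sum_congr rfl fun j _ => mul_comm _ _
    · rw [Finset.sum_comm]
      refine Finset.sum_congr rfl fun i _ => ?_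
      rw [← hc i, Finset.sum_mul]
      refine Finset.sum_congr rfl fun j _ => ?_
      simp only [δ, LinearMap.comp_apply, LinearMap.snd_apply, LinearMap.proj_apply]
      ring
  have hK' : ProjDimLT R (cycleIdeal F ℓ) s := projDimLT_cycleIdeal hpd hht hw
  have hJK : J ≤ cycleIdeal F ℓ := by
    refine Ideal.span_le.mpr ?_
    rintro _ ⟨i, rfl⟩
    -- Every ℓ_k vanishes at u = (c_i, -e_i), while F(u) = γ_i.
    have h1 := apply_mem_cycleIdeal (F := F) (ℓ := ℓ) (e := fun j => (Pi.single j 1, 0))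
      (u := (c i, -Pi.single i 1)) (fun j k => by rw [hℓ]; simp [Pi.single_apply])
      (fun k => by rw [hℓ]; simp [Pi.single_apply])
    rwa [hF, hc] at h1
  have heq : J.colon (I : Set R) = cycleIdeal F ℓ := by
    refine le_antisymm (le_of_mul_mem_of_height hK' ?_ ?_ hht') fun a ha => ?_
    · intro a ha i hi
      rw [mul_comm]
      exact hJK (Submodule.mem_colon.mp ha i hi)
    · intro x hx
      obtain ⟨w, hw1, hw2⟩ := hw x hx
      exact ⟨r, pow_mem_cycleIdeal hw1 hw2⟩
    · exact (hcolon a).mpr fun k => mul_mem_of_mem_cycleIdeal hγJ hsum ha k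
  refine isPerfect_and_grade_eq hne hht ?_
  rw [heq]
  exact projDimLT_quotient_of_projDimLT hK'
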